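/- Let $n\ge 1$. A noncrossing matching of order $n$ is a map $\pi:\{1,\dots,2n\}\to\{1,\dots,2n\}$ with $\pi\circ\pi=\mathrm{id}$ and $\pi(k)\ne k$ for all $k$, such that there are no $a<b<c<d$ with $\pi(a)=c$ and $\pi(b)=d$; let $\mathrm{NC}_n$ be the set of these. For $1\le k\le 2n$ (with $k+1$ read as $1$ if $k=2n$) the cyclic Temperley--Lieb operator $e_k:\mathrm{NC}_n\to\mathrm{NC}_n$ sends $\pi$ to the matching in which $k$ is matched to $k+1$, $\pi(k)$ is matched to $\pi(k+1)$ (if $\pi(k)\neq k+1$), and all other pairs are as in $\pi$. Cylindrical loop percolation of order $n$ is the following random graph. Its vertices are the points $(x,y)\in\mathbb Z^2$ with $x+y\ge 0$, where points differing by a multiple of $(2n,-2n)$ are identified. For each (class of) unit lattice square with bottom-left corner $(x,y)$, $x+y$ even, $x+y\ge 0$, a fair coin is tossed, independently for different squares; according to the result, either the bottom and top edges or the left and right edges of the square are included in the graph. The connectivity pattern $\Pi$ matches $j$ to $k$ (for distinct $j,k\in\{1,\dots,2n\}$) if the path of the graph starting at the boundary vertex $(j,-j)$ ends at the boundary vertex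 $(k,-k)$. For $\pi\in\mathrm{NC}_n$ put $\mu_\pi=\mathbb P(\Pi=\pi)$, and let $\boldsymbol\mu_n=(\mu_\pi)_{\pi\in\mathrm{NC}_n}$, regarded as a row vector. Theorem. The pattern $\Pi$ is almost surely a noncrossing matching, that is, $\sum_{\pi\in\mathrm{NC}_n}\mu_\pi=1$; and if $H_n$ denotes the square matrix with rows and columns indexed by $\mathrm{NC}_n$ and entries $$(H_n)_{\pi,\pi'}=2n\,\delta_{\pi,\pi'}-\#\{1\le k\le 2n: e_k(\pi)=\pi'\},$$ then $\boldsymbol\mu_n H_n=0$. -/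

import Mathlib

/-!
The numbers `1, …, 2n` are represented by `Fin (2 * n)`, the element `i` standing for the number
`i + 1`.  The cyclic successor (`k + 1`, read as `1` when `k = 2n`) is `finRotate (2 * n)`.
-/

/-- `π` is a noncrossing (perfect) matching of `1, …, 2n`; `π k` is the number matched to `k`. -/
structure IsNoncrossingMatching (n : ℕ) (π : Fin (2 * n) → Fin (2 * n)) : Prop where
  involutive : ∀ k, π (π k) = k
  ne_self : ∀ k, π k ≠ k
  noncrossing : ¬ ∃ a b c d : Fin (2 * n), a < b ∧ b < c ∧ c < d ∧ π a = c ∧ π b = d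

/-- The set of noncrossing matchings of order `n`. -/
abbrev NCMatching (n : ℕ) : Type :=
  {π : Fin (2 * n) → Fin (2 * n) // IsNoncrossingMatching n π}

noncomputable instance instFintypeNCMatching (n : ℕ) : Fintype (NCMatching n) :=
  Fintype.ofFinite _

/-- The function underlying the Temperley-Lieb operator: `k` is matched with its cyclic successor,
and the former partners of these two points are matched with each other. -/
def temperleyLiebFun {n : ℕ} (k : Fin (2 * n)) (π : Fin (2 * n) → Fin (2 * n)) :
    Fin (2 * n) → Fin (2 * n) := fun m =>
  if m = k then finRotate (2 * n) k
  else if m = finRotate (2 * n) k then k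
  else if m = π k then π (finRotate (2 * n) k)
  else if m = π (finRotate (2 * n) k) then π k
  else π m

theorem val_finRotate_two_mul {n : ℕ} (k : Fin (2 * n)) :
    ((finRotate (2 * n) k : Fin (2 * n)) : ℕ) =
      if (k : ℕ) + 1 = 2 * n then 0 else (k : ℕ) + 1 := by
  rcases k with ⟨k, hk⟩
  obtain ⟨m, hm⟩ : ∃ m, 2 * n = m + 1 := ⟨2 * n - 1, by omega⟩
  generalize 2 * n = N at *
  subst hm
  rw [coe_finRotate]
  simp [Fin.ext_iff]

theorem isNoncrossingMatching_temperleyLiebFun {n : ℕ} (k : Fin (2 * n))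
    {π : Fin (2 * n) → Fin (2 * n)} (h : IsNoncrossingMatching n π) :
    IsNoncrossingMatching n (temperleyLiebFun k π) := by
  have hr := val_finRotate_two_mul k
  obtain ⟨inv, ne, nc⟩ := h
  have hk := k.isLt
  have hne : finRotate (2 * n) k ≠ k := by
    intro h
    rw [h] at hr
    split_ifs at hr <;> omega
  generalize hl : finRotate (2 * n) k = l at hr hne
  have inj : ∀ x y, π x = π y → x = y := fun x y hxy => by rw [← inv x, hxy, inv]
  refine ⟨?_, ?_, ?_⟩
  · intro m
    simp only [temperleyLiebFun, hl]
    grind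
  · intro m
    simp only [temperleyLiebFun, hl]
    grind
  · have nc' : ∀ x y : Fin (2 * n), ¬ ((x : ℕ) < y ∧ (y : ℕ) < π x ∧ (π x : ℕ) < π y) := by
      intro x y hxy
      exact nc ⟨x, y, π x, π y, hxy.1, hxy.2.1, hxy.2.2, rfl, rfl⟩
    rintro ⟨x, y, z, w, hxy, hyz, hzw, hz, hw⟩
    have key : ∀ p q y w a b : ℕ, (if p + 1 = 2 * n then q = 0 else q = p + 1) → p < 2 * n →
        y ≠ p → y ≠ q → w ≠ p → w ≠ q →
        (¬ (a < y ∧ y < p ∧ p < w)) → (¬ (p < y ∧ y < a ∧ a < w)) →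
        (¬ (y < a ∧ a < w ∧ w < p)) → (¬ (y < p ∧ p < w ∧ w < a)) →
        (¬ (b < y ∧ y < q ∧ q < w)) → (¬ (q < y ∧ y < b ∧ b < w)) →
        (¬ (y < b ∧ b < w ∧ w < q)) → (¬ (y < q ∧ q < w ∧ w < b)) →
        w < 2 * n → a ≠ y → a ≠ w → b ≠ y → b ≠ w →
        ((y < a ∧ a < w) ↔ (y < b ∧ b < w)) ∨ w ≤ y := by
      intro p q y w a b h1
      split_ifs at h1 <;> omega
    have hr' : if (k : ℕ) + 1 = 2 * n then (l : ℕ) = 0 else (l : ℕ) = k + 1 := by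
      split_ifs at hr ⊢ <;> exact hr
    have sep : ∀ y, y ≠ k → y ≠ l → y ≠ π k → y ≠ π l → (y : ℕ) < π y →
        (((y : ℕ) < π k ∧ (π k : ℕ) < π y) ↔ ((y : ℕ) < π l ∧ (π l : ℕ) < π y)) := by
      intro y h1 h2 h3 h4 hlt
      have a1 := nc' (π k) y
      have a2 := nc' k y
      have a3 := nc' y (π k)
      have a4 := nc' y k
      have b1 := nc' (π l) y
      have b2 := nc' l y
      have b3 := nc' y (π l)
      have b4 := nc' y l
      rw [inv] at a1 a3 b1 b3
      have c1 : π y ≠ k := fun e => h3 (by rw [← e, inv])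
      have c2 : π y ≠ l := fun e => h4 (by rw [← e, inv])
      have c3 : π k ≠ π y := fun e => h1 (inj _ _ e).symm
      have c4 : π l ≠ π y := fun e => h2 (inj _ _ e).symm
      have := key k l y (π y) (π k) (π l) hr' hk (Fin.val_ne_of_ne h1) (Fin.val_ne_of_ne h2)
        (Fin.val_ne_of_ne c1) (Fin.val_ne_of_ne c2) a1 a2 a3 a4 b1 b2 b3 b4 (π y).isLt
        (Fin.val_ne_of_ne h3.symm) (Fin.val_ne_of_ne c3) (Fin.val_ne_of_ne h4.symm)
        (Fin.val_ne_of_ne c4)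
      omega
    have hlv := hr'
    have zl := z.isLt
    have wl := w.isLt
    simp only [temperleyLiebFun, hl] at hz hw
    rw [Fin.lt_def] at hxy hyz hzw
    have hx := nc' x y
    have sx := sep x
    have sy := sep y
    split_ifs at hz hw hlv <;> (subst_vars; omega)

/-- The Temperley-Lieb operator `e_k` on noncrossing matchings. -/
def temperleyLieb {n : ℕ} (k : Fin (2 * n)) (π : NCMatching n) : NCMatching n :=
  ⟨temperleyLiebFun k π.1, isNoncrossingMatching_temperleyLiebFun k π.2⟩

open Classical in
/-- The matrix `H_n`, with entries `2n δ_{π,π'} - #{k : e_k(π) = π'}`. -/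
noncomputable def hamiltonian (n : ℕ) : Matrix (NCMatching n) (NCMatching n) ℝ := fun π π' =>
  (if π = π' then 2 * (n : ℝ) else 0) -
    ((Finset.univ.filter fun k : Fin (2 * n) => temperleyLieb k π = π').card : ℝ)

/-- A vertex of the cylinder `{(x, y) ∈ ℤ² : x + y ≥ 0}` modulo translation by `(2n, -2n)`.
The pair `(c, r)` stands for the class of the lattice points `(x, y)` with `x ≡ c + 1` modulo `2n`
(so that `c` represents the number `c + 1`) and `x + y = r`. -/
abbrev CylinderVertex (n : ℕ) : Type := Fin (2 * n) × ℕ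

/-- A white square of the cylinder: the pair `(c, s)` stands for the unit square whose bottom-left
corner is the vertex `(c, 2 * s)`. (White squares are those whose bottom-left corner `(x, y)` has
`x + y` even.) A configuration assigns a coin to each white square: `true` means that the square
contributes its bottom and top edges, `false` that it contributes its left and right edges. -/
abbrev CylinderConfig (n : ℕ) : Type := Fin (2 * n) × ℕ → Bool

/-- The edges of the cylindrical loop percolation graph. A unit step to the right raises both
coordinates of a `CylinderVertex`, a unit step upwards raises only the second one. -/
inductive LoopEdge {n : ℕ} (ω : CylinderConfig n) : CylinderVertex n → CylinderVertex n → Prop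
  | bottom (c : Fin (2 * n)) (s : ℕ) (h : ω (c, s) = true) :
      LoopEdge ω (c, 2 * s) (finRotate (2 * n) c, 2 * s + 1)
  | top (c : Fin (2 * n)) (s : ℕ) (h : ω (c, s) = true) :
      LoopEdge ω (c, 2 * s + 1) (finRotate (2 * n) c, 2 * s + 2)
  | left (c : Fin (2 * n)) (s : ℕ) (h : ω (c, s) = false) :
      LoopEdge ω (c, 2 * s) (c, 2 * s + 1)
  | right (c : Fin (2 * n)) (s : ℕ) (h : ω (c, s) = false) :
      LoopEdge ω (finRotate (2 * n) c, 2 * s + 1) (finRotate (2 * n) c, 2 * s + 2)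

/-- The cylindrical loop percolation graph of a configuration. -/
def loopGraph {n : ℕ} (ω : CylinderConfig n) : SimpleGraph (CylinderVertex n) :=
  SimpleGraph.fromRel (LoopEdge ω)

/-- The points `i` and `j` are matched in the connectivity pattern: the path of the graph that
starts at the boundary vertex `i` re-emerges at the boundary vertex `j`. (Boundary vertices have
degree `1` and all other vertices have degree `2`, so every component of the graph that meets the
boundary is a path which ends at another boundary vertex or is infinite.) -/
def PathMatched {n : ℕ} (ω : CylinderConfig n) (i j : Fin (2 * n)) : Prop :=
  i ≠ j ∧ (loopGraph ω).Reachable (i, 0) (j, 0)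

/-- The event that the connectivity pattern of the configuration is the matching `π`. -/
def connectivityEvent {n : ℕ} (π : NCMatching n) : Set (CylinderConfig n) :=
  {ω | ∀ i j, PathMatched ω i j ↔ π.1 i = j}

/-- The law of a random configuration: independent fair coins. -/
noncomputable def loopMeasure (n : ℕ) : MeasureTheory.Measure (CylinderConfig n) :=
  MeasureTheory.Measure.infinitePi fun _ => (PMF.uniformOfFintype Bool).toMeasure

/-- The distribution `μ_n` of the connectivity pattern of cylindrical loop percolation, as a (row)
vector indexed by the noncrossing matchings of order `n`. -/
noncomputable def connectivityDistribution (n : ℕ) : NCMatching n → ℝ := fun π =>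
  (loopMeasure n).real (connectivityEvent π)

/-! Peel off the lowest row of squares. If the configuration above it has pattern `π` and the row
has coins `w`, the whole has pattern `rowMap w π`. The lowest row is uniform and independent of the
rows above, which have the same law as the whole, so `μ` is stationary under the row transfer
operator (`sum_connectivityDistribution_rowMap`).

The main point is that the sum of all `e_k` commutes with this operator
(`sum_temperleyLieb_rowMap`). Cut open at a square showing `false`, a row acts as an ordered product
of the factors `e_i` over the other squares showing `true`. The relations `e_k e_k = e_k`, `e_k
e_{k±1} e_k = e_k` and far commutativity show that, after resampling the coins at `k` and `k + 1`,
the difference of `e_k ∘ R_w` and `R_w ∘ e_{k+1}` is a weighted difference of two row maps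
(`sum_commutator_local`). These differences cancel in the sum over `k`. The row with all coins
`true` has no such cut; it rotates by two steps and is treated separately.

Hence `ν = μ H` is fixed by the same operator, and its entries sum to `0`. The row with alternating
coins sends every pattern to one and the same matching, so the operator strictly contracts the `ℓ¹`
norm on vectors of sum zero, and `ν = 0`. The alternating row also shows that a pattern exists
almost surely: it closes all paths within a single row. -/

open Relation MeasureTheory

/-! ### Temperley–Lieb relations at loop weight 1 -/

theorem finRotate_two_mul_ne {n : ℕ} (k : Fin (2 * n)) : finRotate (2 * n) k ≠ k := by
  intro h
  have hr := val_finRotate_two_mul k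
  have := k.isLt
  rw [h] at hr
  split_ifs at hr <;> omega

theorem temperleyLieb_idem {n : ℕ} (k : Fin (2 * n)) (π : NCMatching n) :
    temperleyLieb k (temperleyLieb k π) = temperleyLieb k π := by
  obtain ⟨π, hπ⟩ := π
  apply Subtype.ext
  funext m
  have inv := hπ.involutive
  have ne := hπ.ne_self
  have := finRotate_two_mul_ne k
  simp only [temperleyLieb, temperleyLiebFun]
  grind

/-- The hypothesis excludes the cycle of length two, where the successor of `k + 1` is `k` again. -/
theorem temperleyLieb_braid {n : ℕ} (k : Fin (2 * n)) (hk : finRotate (2 * n) (finRotate (2 * n) k) ≠ k) (π : NCMatching n) :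
    temperleyLieb k (temperleyLieb (finRotate (2 * n) k) (temperleyLieb k π)) = temperleyLieb k π := by
  obtain ⟨π, hπ⟩ := π
  apply Subtype.ext
  funext m
  have inv := hπ.involutive
  have ne := hπ.ne_self
  have h1 := finRotate_two_mul_ne k
  have h2 := finRotate_two_mul_ne (finRotate (2 * n) k)
  simp only [temperleyLieb, temperleyLiebFun]
  clear hπ
  generalize finRotate (2 * n) (finRotate (2 * n) k) = l2 at *
  generalize finRotate (2 * n) k = l at *
  grind

theorem temperleyLieb_braid' {n : ℕ} (k : Fin (2 * n)) (hk : finRotate (2 * n) (finRotate (2 * n) k) ≠ k) (π : NCMatching n) :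
    temperleyLieb (finRotate (2 * n) k) (temperleyLieb k (temperleyLieb (finRotate (2 * n) k) π)) = temperleyLieb (finRotate (2 * n) k) π := by
  obtain ⟨π, hπ⟩ := π
  apply Subtype.ext
  funext m
  have inv := hπ.involutive
  have ne := hπ.ne_self
  have h1 := finRotate_two_mul_ne k
  have h2 := finRotate_two_mul_ne (finRotate (2 * n) k)
  simp only [temperleyLieb, temperleyLiebFun]
  clear hπ
  generalize finRotate (2 * n) (finRotate (2 * n) k) = l2 at *
  generalize finRotate (2 * n) k = l at *
  grind

theorem temperleyLieb_comm {n : ℕ} (j k : Fin (2 * n)) (h : j ≠ k) (hj : finRotate (2 * n) j ≠ k)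
    (hk : finRotate (2 * n) k ≠ j) (π : NCMatching n) :
    temperleyLieb j (temperleyLieb k π) = temperleyLieb k (temperleyLieb j π) := by
  obtain ⟨π, hπ⟩ := π
  apply Subtype.ext
  funext m
  have inv := hπ.involutive
  have ne := hπ.ne_self
  have h1 := finRotate_two_mul_ne k
  have h2 := finRotate_two_mul_ne j
  have h3 := (finRotate (2 * n)).injective.ne h
  simp only [temperleyLieb, temperleyLiebFun, h, h.symm, hj, hj.symm, hk, hk.symm, h3, h3.symm, if_false]
  grind (splits := 30)

/-! ### Rotation of matchings -/

/-- Rotation of a matching by one step. -/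
def rotateFun {n : ℕ} (π : Fin (2 * n) → Fin (2 * n)) : Fin (2 * n) → Fin (2 * n) :=
  fun i => (finRotate (2 * n)).symm (π (finRotate (2 * n) i))

theorem isNoncrossingMatching_rotateFun {n : ℕ} {π : Fin (2 * n) → Fin (2 * n)}
    (h : IsNoncrossingMatching n π) : IsNoncrossingMatching n (rotateFun π) := by
  obtain ⟨inv, ne, nc⟩ := h
  refine ⟨fun k => by simp only [rotateFun, Equiv.apply_symm_apply, inv, Equiv.symm_apply_apply],
    fun k hk => ?_, ?_⟩
  · rw [rotateFun, Equiv.symm_apply_eq] at hk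
    exact ne _ hk
  · rintro ⟨a, b, c, d, hab, hbc, hcd, hc, hd⟩
    rw [rotateFun, Equiv.symm_apply_eq] at hc hd
    have ha := val_finRotate_two_mul a
    have hb := val_finRotate_two_mul b
    have hc' := val_finRotate_two_mul c
    have hd' := val_finRotate_two_mul d
    have nc1 : ¬ (finRotate (2 * n) a < finRotate (2 * n) b ∧
        finRotate (2 * n) b < finRotate (2 * n) c ∧ finRotate (2 * n) c < finRotate (2 * n) d) :=
      fun h => nc ⟨_, _, _, _, h.1, h.2.1, h.2.2, hc, hd⟩
    have nc2 : ¬ (finRotate (2 * n) d < finRotate (2 * n) a ∧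
        finRotate (2 * n) a < finRotate (2 * n) b ∧ finRotate (2 * n) b < finRotate (2 * n) c) :=
      fun h => nc ⟨_, _, _, _, h.1, h.2.1, h.2.2, by rw [← hd, inv], hc⟩
    rw [Fin.lt_def] at hab hbc hcd
    simp only [Fin.lt_def, ha, hb, hc', hd'] at nc1 nc2
    have := d.isLt
    split_ifs at nc1 nc2 <;> omega

/-- Rotation by one step as an operator on noncrossing matchings. -/
def rotateMatching {n : ℕ} (π : NCMatching n) : NCMatching n :=
  ⟨rotateFun π.1, isNoncrossingMatching_rotateFun π.2⟩

theorem rotateMatching_temperleyLieb {n : ℕ} (k : Fin (2 * n)) (π : NCMatching n) :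
    rotateMatching (temperleyLieb (finRotate (2 * n) k) π) =
      temperleyLieb k (rotateMatching π) := by
  apply Subtype.ext
  funext m
  simp only [rotateMatching, temperleyLieb, temperleyLiebFun, rotateFun, Equiv.eq_symm_apply,
    (finRotate (2 * n)).injective.eq_iff]
  split_ifs <;> simp only [Equiv.symm_apply_apply]

/-! ### Sweeps through consecutive squares -/

/-- The effect of a white square with coin `b` at position `k`. -/
def coinStep {n : ℕ} (b : Bool) (k : Fin (2 * n)) (π : NCMatching n) : NCMatching n :=
  if b then temperleyLieb k π else π

/-- The effect of the `j` consecutive white squares of a row which start at `p`. -/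
def sweep {n : ℕ} (w : Fin (2 * n) → Bool) (p : Fin (2 * n)) : ℕ → NCMatching n → NCMatching n
  | 0, π => π
  | j + 1, π => coinStep (w ((finRotate (2 * n))^[j] p)) ((finRotate (2 * n))^[j] p) (sweep w p j π)

theorem sweep_add {n : ℕ} (w : Fin (2 * n) → Bool) (p : Fin (2 * n)) (a b : ℕ)
    (π : NCMatching n) :
    sweep w p (a + b) π = sweep w ((finRotate (2 * n))^[a] p) b (sweep w p a π) := by
  induction b with
  | zero => rfl
  | succ b ih => 
    rw [← Nat.add_assoc, sweep, sweep, ih, ← Function.iterate_add_apply, Nat.add_comm b a]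

theorem sweep_congr {n : ℕ} {w w' : Fin (2 * n) → Bool} {p : Fin (2 * n)} {j : ℕ}
    (h : ∀ i < j, w ((finRotate (2 * n))^[i] p) = w' ((finRotate (2 * n))^[i] p))
    (π : NCMatching n) : sweep w p j π = sweep w' p j π := by
  induction j with
  | zero => rfl
  | succ j ih => rw [sweep, sweep, ih fun i hi => h i (by omega), h j (by omega)]

/-- The hypothesis keeps every swept position different from `k - 1`, `k` and `k + 1`, so each
factor commutes with `e_k`. -/
theorem sweep_comm {n : ℕ} {w : Fin (2 * n) → Bool} {p k : Fin (2 * n)} {j : ℕ}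
    (h : ∀ i < j, (finRotate (2 * n))^[i] p ≠ k ∧ (finRotate (2 * n))^[i + 1] p ≠ k ∧
      (finRotate (2 * n))^[i] p ≠ finRotate (2 * n) k) (π : NCMatching n) :
    sweep w p j (temperleyLieb k π) = temperleyLieb k (sweep w p j π) := by
  induction j with
  | zero => rfl
  | succ j ih =>
    obtain ⟨h1, h2, h3⟩ := h j (by omega)
    rw [Function.iterate_succ_apply'] at h2
    rw [sweep, sweep, ih fun i hi => h i (by omega), coinStep, coinStep]
    split_ifs
    · exact temperleyLieb_comm _ _ h1 h2 h3.symm _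
    · rfl

/-! ### Arithmetic of the cyclic order -/

/-- The number of steps from `p` to `q` in the cyclic order. -/
def cyclicOffset {n : ℕ} (p q : Fin (2 * n)) : ℕ :=
  if p ≤ q then (q : ℕ) - p else q + 2 * n - p

theorem cyclicOffset_lt {n : ℕ} (p q : Fin (2 * n)) : cyclicOffset p q < 2 * n := by
  have := p.isLt
  have := q.isLt
  simp only [cyclicOffset, Fin.le_def]
  split_ifs <;> omega

theorem cyclicOffset_injective {n : ℕ} (p : Fin (2 * n)) :
    Function.Injective (cyclicOffset p) := by
  intro q r h
  have := p.isLt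
  have := q.isLt
  have := r.isLt
  simp only [cyclicOffset, Fin.le_def] at h
  apply Fin.ext
  split_ifs at h <;> omega

theorem cyclicOffset_self {n : ℕ} (p : Fin (2 * n)) : cyclicOffset p p = 0 := by
  simp [cyclicOffset]

theorem cyclicOffset_finRotate {n : ℕ} (p q : Fin (2 * n)) :
    cyclicOffset p (finRotate (2 * n) q) =
      if cyclicOffset p q + 1 = 2 * n then 0 else cyclicOffset p q + 1 := by
  have := p.isLt
  have := q.isLt
  have hq := val_finRotate_two_mul q
  simp only [cyclicOffset, Fin.le_def, hq]
  split_ifs <;> omega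

theorem cyclicOffset_iterate {n : ℕ} (p : Fin (2 * n)) {j : ℕ} (hj : j < 2 * n) :
    cyclicOffset p ((finRotate (2 * n))^[j] p) = j := by
  induction j with
  | zero => exact cyclicOffset_self p
  | succ j ih =>
    rw [Function.iterate_succ_apply', cyclicOffset_finRotate, ih (by omega), if_neg (by omega)]

theorem iterate_cyclicOffset {n : ℕ} (p q : Fin (2 * n)) :
    (finRotate (2 * n))^[cyclicOffset p q] p = q :=
  cyclicOffset_injective p (cyclicOffset_iterate p (cyclicOffset_lt p q))

theorem iterate_finRotate_two_mul {n : ℕ} (p : Fin (2 * n)) :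
    (finRotate (2 * n))^[2 * n] p = p := by
  have := p.isLt
  apply cyclicOffset_injective p
  obtain ⟨m, hm⟩ : ∃ m, 2 * n = m + 1 := ⟨2 * n - 1, by omega⟩
  have h := cyclicOffset_iterate p (j := m) (by omega)
  rw [cyclicOffset_self, congrArg (fun j => (finRotate (2 * n))^[j] p) hm,
    Function.iterate_succ_apply',
    cyclicOffset_finRotate, h, if_pos hm.symm]

theorem iterate_finRotate_eq_iff {n : ℕ} (p : Fin (2 * n)) {i j : ℕ} (hi : i < 2 * n)
    (hj : j < 2 * n) : (finRotate (2 * n))^[i] p = (finRotate (2 * n))^[j] p ↔ i = j := by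
  refine ⟨fun h => ?_, fun h => by rw [h]⟩
  rw [← cyclicOffset_iterate p hi, h, cyclicOffset_iterate p hj]

/-! ### Connectivity after adding edges -/

theorem eqvGen_map {α β : Type*} {E : α → α → Prop} {E' : β → β → Prop} (φ : α → β)
    (h : ∀ x y, E x y → EqvGen E' (φ x) (φ y)) {x y : α} (hxy : EqvGen E x y) :
    EqvGen E' (φ x) (φ y) := by
  induction hxy with
  | rel a b hab => exact h a b hab
  | refl a => exact .refl _
  | symm a b _ ih => exact .symm _ _ ih
  | trans a b c _ _ ih1 ih2 => exact .trans _ _ _ ih1 ih2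

/-- A map that moves points only within their `E'`-classes and sends `E'`-edges to `E`-connections
contracts the added part of the graph onto the old one. This replaces any analysis of individual
paths. -/
theorem eqvGen_iff_of_retract {α : Type*} {E E' : α → α → Prop} (φ : α → α)
    (h1 : E ≤ E') (h2 : ∀ x, EqvGen E' x (φ x))
    (h3 : ∀ x y, E' x y → EqvGen E (φ x) (φ y)) (x y : α) :
    EqvGen E' x y ↔ EqvGen E (φ x) (φ y) :=
  ⟨eqvGen_map φ h3, fun h => .trans _ _ _ (h2 x)
    (.trans _ _ _ (EqvGen.mono h1 _ _ h) (.symm _ _ (h2 y)))⟩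

/-- The relation with the single edge from `a` to `b`. -/
def singleEdge {α : Type*} (a b : α) : α → α → Prop := fun x y => x = a ∧ y = b

/-- A connection in the enlarged graph uses the new edge effectively at most once, in one direction
or the other. -/
theorem eqvGen_sup_singleEdge {α : Type*} {E : α → α → Prop} (a b x y : α) :
    EqvGen (E ⊔ singleEdge a b) x y ↔
      EqvGen E x y ∨ (EqvGen E x a ∧ EqvGen E b y) ∨ (EqvGen E x b ∧ EqvGen E a y) := by
  have hE : Equivalence (EqvGen E) := EqvGen.is_equivalence E
  constructor
  · intro h
    induction h with
    | rel x y h =>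
      rcases h with h | ⟨rfl, rfl⟩
      · exact .inl (.rel _ _ h)
      · exact .inr (.inl ⟨.refl _, .refl _⟩)
    | refl x => exact .inl (.refl x)
    | symm x y _ ih =>
      rcases ih with h | ⟨h1, h2⟩ | ⟨h1, h2⟩
      · exact .inl h.symm
      · exact .inr (.inr ⟨h2.symm, h1.symm⟩)
      · exact .inr (.inl ⟨h2.symm, h1.symm⟩)
    | trans x y z _ _ ih1 ih2 =>
      have s := fun {x y} => hE.symm (x := x) (y := y)
      have t := fun {x y z} => hE.trans (x := x) (y := y) (z := z)
      rcases ih1 with h | ⟨h1, h2⟩ | ⟨h1, h2⟩ <;> rcases ih2 with h' | ⟨h1', h2'⟩ | ⟨h1', h2'⟩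
      · exact .inl (t h h')
      · exact .inr (.inl ⟨t h h1', h2'⟩)
      · exact .inr (.inr ⟨t h h1', h2'⟩)
      · exact .inr (.inl ⟨h1, t h2 h'⟩)
      · exact .inr (.inl ⟨h1, h2'⟩)
      · exact .inl (t h1 h2')
      · exact .inr (.inr ⟨h1, t h2 h'⟩)
      · exact .inl (t h1 h2')
      · exact .inr (.inr ⟨h1, h2'⟩)
  · have m : EqvGen E ≤ EqvGen (E ⊔ singleEdge a b) := EqvGen.mono le_sup_left
    have e : EqvGen (E ⊔ singleEdge a b) a b := .rel _ _ (.inr ⟨rfl, rfl⟩)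
    rintro (h | ⟨h1, h2⟩ | ⟨h1, h2⟩)
    · exact m _ _ h
    · exact .trans _ _ _ (m _ _ h1) (.trans _ _ _ e (m _ _ h2))
    · exact .trans _ _ _ (m _ _ h1) (.trans _ _ _ (e.symm) (m _ _ h2))

theorem eqvGen_iff_eq_of_isolated {α : Type*} {E : α → α → Prop} {u : α}
    (h : ∀ x, ¬ E u x ∧ ¬ E x u) (x : α) : EqvGen E u x ↔ u = x := by
  refine ⟨fun hx => ?_, fun hx => hx ▸ .refl _⟩
  have : (u = u ↔ u = x) := by
    have h' : ∀ a b, EqvGen E a b → (u = a ↔ u = b) := by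
      intro a b hab
      induction hab with
      | rel a b hab =>
        constructor <;> rintro rfl
        · exact absurd hab (h b).1
        · exact absurd hab (h a).2
      | refl a => rfl
      | symm a b _ ih => exact ih.symm
      | trans a b c _ _ ih1 ih2 => exact ih1.trans ih2
    exact h' u x hx
  exact this.1 rfl

/-! ### Patterns along a height profile -/

/-- The relation `E` connects the points `(i, h i)` according to `π`. -/
def HasPattern {n : ℕ} (E : CylinderVertex n → CylinderVertex n → Prop) (h : Fin (2 * n) → ℕ)
    (π : Fin (2 * n) → Fin (2 * n)) : Prop :=
  ∀ i j, EqvGen E (i, h i) (j, h j) ↔ i = j ∨ π i = j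

/-- All edges of `E` lie weakly above the height function `h`. -/
def LivesAbove {n : ℕ} (E : CylinderVertex n → CylinderVertex n → Prop) (h : Fin (2 * n) → ℕ) :
    Prop :=
  ∀ x y, E x y → h x.1 ≤ x.2 ∧ h y.1 ≤ y.2

theorem HasPattern.unique {n : ℕ} {E : CylinderVertex n → CylinderVertex n → Prop}
    {h : Fin (2 * n) → ℕ} {π π' : NCMatching n} (h1 : HasPattern E h π.1)
    (h2 : HasPattern E h π'.1) : π = π' := by
  apply Subtype.ext
  funext i
  have := (h2 i (π.1 i)).1 ((h1 i (π.1 i)).2 (.inr rfl))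
  rcases this with h | h
  · exact absurd h.symm (π.2.ne_self i)
  · exact h.symm

/-- A vertical edge hung below column `k` only extends one path by a step. `LivesAbove` guarantees
that its lower endpoint was not used before. -/
theorem HasPattern.column {n : ℕ} {E : CylinderVertex n → CylinderVertex n → Prop}
    {h h' : Fin (2 * n) → ℕ} {π : Fin (2 * n) → Fin (2 * n)} (hE : LivesAbove E h)
    (hp : HasPattern E h π) (k : Fin (2 * n)) (r : ℕ) (hk : h k = r + 1)
    (hh : h' = Function.update h k r) :
    LivesAbove (E ⊔ singleEdge (k, r) (k, r + 1)) h' ∧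
      HasPattern (E ⊔ singleEdge (k, r) (k, r + 1)) h' π := by
  subst hh
  constructor
  · rintro ⟨a, s⟩ ⟨b, t⟩ (hxy | ⟨hx, hy⟩)
    · have := hE _ _ hxy
      simp only [Function.update_apply] at this ⊢
      constructor <;> split_ifs <;> grind
    · simp only [Prod.mk.injEq] at hx hy
      obtain ⟨rfl, rfl⟩ := hx
      obtain ⟨rfl, rfl⟩ := hy
      simp
  · intro i j
    -- The retraction pushes the new endpoint back up its edge.
    rw [← hp i j, eqvGen_iff_of_retract (E := E)
      (fun x => if x = (k, r) then (k, r + 1) else x) le_sup_left]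
    · have : ∀ i, (if (i, Function.update h k r i) = (k, r) then (k, r + 1) else
          (i, Function.update h k r i)) = (i, h i) := by
        intro i
        by_cases hi : i = k
        · subst hi
          simp [hk]
        · simp [hi]
      rw [this, this]
    · intro x
      split_ifs with hx
      · exact .rel _ _ (.inr ⟨hx, rfl⟩)
      · exact .refl _
    · rintro x y (hxy | ⟨rfl, rfl⟩)
      · have := hE _ _ hxy
        rw [if_neg, if_neg]
        · exact .rel _ _ hxy
        · rintro rfl; simp [hk] at this
        · rintro rfl; simp [hk] at this
      · simp [EqvGen.refl]

/-- The edges of the white square at position `k` of the lowest row, with coin `b`. -/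
def SquareEdge {n : ℕ} (b : Bool) (k : Fin (2 * n)) : CylinderVertex n → CylinderVertex n → Prop :=
  if b then singleEdge (k, 0) (finRotate (2 * n) k, 1) ⊔ singleEdge (k, 1) (finRotate (2 * n) k, 2)
  else singleEdge (finRotate (2 * n) k, 1) (finRotate (2 * n) k, 2) ⊔ singleEdge (k, 0) (k, 1)

-- The square fits into a step of the profile. With coin `false` its two vertical edges extend the
-- paths in columns `k` and `k + 1`. With coin `true` the top edge joins the two old path ends, and
-- the bottom edge joins the two fresh boundary points to each other, which is the action of `e_k`.
set_option linter.unusedSimpArgs false in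
theorem HasPattern.square {n : ℕ} {E : CylinderVertex n → CylinderVertex n → Prop}
    {h h' : Fin (2 * n) → ℕ} {π : NCMatching n} (hE : LivesAbove E h)
    (hp : HasPattern E h π.1) (k : Fin (2 * n)) (hk : h k = 1) (hl : h (finRotate (2 * n) k) = 2)
    (hh : h' = Function.update (Function.update h k 0) (finRotate (2 * n) k) 1) (b : Bool) :
    LivesAbove (E ⊔ SquareEdge b k) h' ∧ HasPattern (E ⊔ SquareEdge b k) h' (coinStep b k π).1 := by
  subst hh
  have hne := finRotate_two_mul_ne k
  cases b with
  | false =>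
    obtain ⟨h1, h2⟩ := HasPattern.column hE hp (finRotate (2 * n) k) 1 hl rfl
    have := HasPattern.column (h' := Function.update (Function.update h k 0) (finRotate (2 * n) k) 1)
      h1 h2 k 0 (by rw [Function.update_of_ne hne.symm, hk]) (by
        rw [Function.update_comm hne.symm])
    simpa [SquareEdge, coinStep, sup_assoc] using this
  | true =>
    simp only [SquareEdge, coinStep, if_true]
    generalize hl' : finRotate (2 * n) k = l at *
    have heq : E ⊔ (singleEdge (k, 0) (l, 1) ⊔ singleEdge (k, 1) (l, 2)) =
        (E ⊔ singleEdge (k, 1) (l, 2)) ⊔ singleEdge (k, 0) (l, 1) := by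
      rw [sup_comm (singleEdge _ _), sup_assoc]
    constructor
    · rintro ⟨a, s⟩ ⟨b, t⟩ (hxy | hxy)
      · have := hE _ _ hxy
        simp only [Function.update_apply] at this ⊢
        constructor <;> split_ifs <;> grind
      · simp only [singleEdge, Pi.sup_apply, sup_Prop_eq, Prod.mk.injEq] at hxy
        simp only [Function.update_apply]
        grind
    -- Both endpoints of the bottom edge lie below the old profile, so they are isolated until that
    -- edge is added.
    · have iso : ∀ u : CylinderVertex n, u = (k, 0) ∨ u = (l, 1) → ∀ x,
          ¬ (E ⊔ singleEdge (k, 1) (l, 2)) u x ∧ ¬ (E ⊔ singleEdge (k, 1) (l, 2)) x u := by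
        intro u hu x
        constructor <;> rintro (hx | ⟨hx, hx'⟩)
        · have := hE _ _ hx
          rcases hu with rfl | rfl <;> simp [hk, hl] at this
        · rcases hu with rfl | rfl <;> simp [hne] at hx
        · have := hE _ _ hx
          rcases hu with rfl | rfl <;> simp [hk, hl] at this
        · rcases hu with rfl | rfl <;> simp at hx'
      have sym : ∀ x y, EqvGen (E ⊔ singleEdge (k, 1) (l, 2)) x y ↔
          EqvGen (E ⊔ singleEdge (k, 1) (l, 2)) y x := fun x y => ⟨.symm _ _, .symm _ _⟩
      have E0 := fun x => eqvGen_iff_eq_of_isolated (iso (k, 0) (.inl rfl)) x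
      have E1 := fun x => eqvGen_iff_eq_of_isolated (iso (l, 1) (.inr rfl)) x
      have E0' := fun x => (sym x _).trans (E0 x)
      have E1' := fun x => (sym x _).trans (E1 x)
      have hp' : ∀ i j, EqvGen E (i, h i) (j, h j) ↔ i = j ∨ π.1 i = j := hp
      have inv := π.2.involutive
      have ne := π.2.ne_self
      -- Away from the two columns only the top edge matters: it merges the classes of the old
      -- partners of `k` and `l`.
      have key : ∀ i, i ≠ k → i ≠ l → ∀ j, j ≠ k → j ≠ l →
          (EqvGen (E ⊔ singleEdge (k, 1) (l, 2)) (i, h i) (j, h j) ↔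
          i = j ∨ temperleyLiebFun k π.1 i = j) := by
        intro i hi hi' j hj hj'
        have ek : ((k, 1) : CylinderVertex n) = (k, h k) := by rw [hk]
        have el : ((l, 2) : CylinderVertex n) = (l, h l) := by rw [hl]
        rw [eqvGen_sup_singleEdge, ek, el]
        simp only [hp', temperleyLiebFun, hl', hi, hi', if_false]
        grind
      intro i j
      rw [heq, eqvGen_sup_singleEdge]
      change _ ↔ i = j ∨ temperleyLiebFun k π.1 i = j
      by_cases hi : i = k
      · subst hi
        by_cases hj : j = i
        · subst hj; simp [EqvGen.refl]
        by_cases hj' : j = l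
        · subst hj'; simp [E0, E1, E0', E1', hne, hne.symm, temperleyLiebFun, hl']
        · simp [E0, E1, E0', E1', hne, hne.symm, temperleyLiebFun, hl', hj, hj', Ne.symm hj,
            Ne.symm hj']
      by_cases hi' : i = l
      · subst hi'
        by_cases hj : j = i
        · subst hj; simp [EqvGen.refl]
        by_cases hj' : j = k
        · subst hj'; simp [E0, E1, E0', E1', hne, hne.symm, temperleyLiebFun, hl']
        · simp [E0, E1, E0', E1', hne, hne.symm, temperleyLiebFun, hl', hj, hj', Ne.symm hj,
            Ne.symm hj']
      by_cases hj : j = k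
      · subst hj
        simp [E0, E1, E0', E1', hne, hne.symm, temperleyLiebFun, hl', hi, hi', Ne.symm hi,
            Ne.symm hi']
        grind
      by_cases hj' : j = l
      · subst hj'
        simp [E0, E1, E0', E1', hne, hne.symm, temperleyLiebFun, hl', hi, hi', Ne.symm hi,
            Ne.symm hi']
        grind
      · have := key i hi hi' j hj hj'
        simpa [E0, E1, E0', E1', hne, hne.symm, hi, hi', Ne.symm hi, Ne.symm hi', hj, hj',
          Ne.symm hj, Ne.symm hj'] using this

/-! ### Adding a whole row -/

/-- The heights of the staircase after `j` white squares of the lowest row, beginning at `p`. -/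
def stairHeight {n : ℕ} (p : Fin (2 * n)) (j : ℕ) (q : Fin (2 * n)) : ℕ :=
  if cyclicOffset p q < j then 0 else if cyclicOffset p q = j then 1 else 2

theorem update_const_eq_stairHeight {n : ℕ} (p : Fin (2 * n)) :
    stairHeight p 0 = Function.update (fun _ => 2) p 1 := by
  funext q
  have h : cyclicOffset p q = 0 ↔ q = p := by
    rw [← cyclicOffset_self p, (cyclicOffset_injective p).eq_iff]
  simp [stairHeight, Function.update_apply, h]

theorem stairHeight_succ {n : ℕ} (p : Fin (2 * n)) {j : ℕ} (hj : j + 1 < 2 * n) :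
    stairHeight p (j + 1) = Function.update (Function.update (stairHeight p j)
      ((finRotate (2 * n))^[j] p) 0) (finRotate (2 * n) ((finRotate (2 * n))^[j] p)) 1 := by
  funext q
  have h1 : q = (finRotate (2 * n))^[j] p ↔ cyclicOffset p q = j := by
    rw [← (cyclicOffset_injective p).eq_iff, cyclicOffset_iterate p (by omega)]
  have h2 : q = (finRotate (2 * n))^[j + 1] p ↔ cyclicOffset p q = j + 1 := by
    rw [← (cyclicOffset_injective p).eq_iff, cyclicOffset_iterate p hj]
  rw [← Function.iterate_succ_apply' (finRotate (2 * n)) j p]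
  simp only [stairHeight, Function.update_apply, h1, h2]
  split_ifs <;> omega

/-- The edges of the `j` consecutive white squares of the lowest row which start at `p`. -/
def sweepEdge {n : ℕ} (w : Fin (2 * n) → Bool) (p : Fin (2 * n)) :
    ℕ → CylinderVertex n → CylinderVertex n → Prop
  | 0 => ⊥
  | j + 1 => sweepEdge w p j ⊔ SquareEdge (w ((finRotate (2 * n))^[j] p)) ((finRotate (2 * n))^[j] p)

/-- The edge below `(p, 2)` creates the step into which the first square fits; each square then
moves the step on by one column. In the application this edge is the right edge of the square where
the row is cut. -/
theorem HasPattern.stair {n : ℕ} {E : CylinderVertex n → CylinderVertex n → Prop}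
    {π : NCMatching n} (hE : LivesAbove E fun _ => 2) (hp : HasPattern E (fun _ => 2) π.1)
    (w : Fin (2 * n) → Bool) (p : Fin (2 * n)) (j : ℕ) (hj : j < 2 * n) :
    LivesAbove (E ⊔ singleEdge (p, 1) (p, 2) ⊔ sweepEdge w p j) (stairHeight p j) ∧
      HasPattern (E ⊔ singleEdge (p, 1) (p, 2) ⊔ sweepEdge w p j) (stairHeight p j)
        (sweep w p j π).1 := by
  induction j with
  | zero =>
    have := HasPattern.column hE hp p 1 rfl (update_const_eq_stairHeight p)
    rwa [sweepEdge, sup_bot_eq]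
  | succ j ih =>
    obtain ⟨h1, h2⟩ := ih (by omega)
    rw [sweepEdge, ← sup_assoc]
    refine HasPattern.square h1 h2 _ ?_ ?_ (stairHeight_succ p hj) _
    · simp [stairHeight, cyclicOffset_iterate p (show j < 2 * n by omega)]
    · rw [← Function.iterate_succ_apply' (finRotate (2 * n)) j p]
      rw [stairHeight, cyclicOffset_iterate p hj, if_neg (by omega), if_neg (by omega)]

/-- The edges of the lowest row of white squares with coins `w`. -/
def RowEdge {n : ℕ} (w : Fin (2 * n) → Bool) (x y : CylinderVertex n) : Prop :=
  ∃ k, SquareEdge (w k) k x y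

theorem sweepEdge_iff {n : ℕ} (w : Fin (2 * n) → Bool) (p : Fin (2 * n)) (j : ℕ)
    (x y : CylinderVertex n) : sweepEdge w p j x y ↔
      ∃ i < j, SquareEdge (w ((finRotate (2 * n))^[i] p)) ((finRotate (2 * n))^[i] p) x y := by
  induction j with
  | zero => simp [sweepEdge]
  | succ j ih =>
    simp only [sweepEdge, Pi.sup_apply, sup_Prop_eq, ih, Nat.lt_succ_iff_lt_or_eq, or_and_right,
      exists_or, exists_eq_left]

/-- A square with coin `false` falls apart into its right edge, needed before the other `2n - 1`
squares are swept, and its left edge, needed after them. -/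
theorem sup_sweepEdge_eq_rowEdge {n : ℕ} (w : Fin (2 * n) → Bool) (c : Fin (2 * n))
    (hc : w c = false) :
    singleEdge (finRotate (2 * n) c, 1) (finRotate (2 * n) c, 2) ⊔
      sweepEdge w (finRotate (2 * n) c) (2 * n - 1) ⊔ singleEdge (c, 0) (c, 1) = RowEdge w := by
  have hn := c.isLt
  have hlast : (finRotate (2 * n))^[2 * n - 1] (finRotate (2 * n) c) = c := by
    rw [← Function.iterate_succ_apply, Nat.succ_eq_add_one, Nat.sub_add_cancel (by omega),
      iterate_finRotate_two_mul]
  have h1 : RowEdge w = sweepEdge w (finRotate (2 * n) c) (2 * n - 1 + 1) := by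
    funext x y
    apply propext
    rw [sweepEdge_iff]
    constructor
    · rintro ⟨k, hk⟩
      refine ⟨cyclicOffset (finRotate (2 * n) c) k, ?_, ?_⟩
      · have := cyclicOffset_lt (finRotate (2 * n) c) k
        omega
      · rwa [iterate_cyclicOffset]
    · rintro ⟨i, -, hi⟩
      exact ⟨_, hi⟩
  rw [h1, sweepEdge, hlast, hc, SquareEdge, if_neg (by simp), sup_right_comm,
    sup_comm (sweepEdge _ _ _) (_ ⊔ _)]

/-- The pattern below a row one of whose coins shows `false`. -/
theorem HasPattern.row {n : ℕ} {E : CylinderVertex n → CylinderVertex n → Prop}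
    {π : NCMatching n} (hE : LivesAbove E fun _ => 2) (hp : HasPattern E (fun _ => 2) π.1)
    (w : Fin (2 * n) → Bool) (c : Fin (2 * n)) (hc : w c = false) :
    HasPattern (E ⊔ RowEdge w) (fun _ => 0)
      (sweep w (finRotate (2 * n) c) (2 * n - 1) π).1 := by
  have hn := c.isLt
  have hoff : cyclicOffset (finRotate (2 * n) c) c = 2 * n - 1 := by
    have h := cyclicOffset_finRotate (finRotate (2 * n) c) c
    rw [cyclicOffset_self] at h
    split_ifs at h
    omega
  obtain ⟨h1, h2⟩ := HasPattern.stair hE hp w (finRotate (2 * n) c) (2 * n - 1) (by omega)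
  -- After the sweep only column `c` is still at height `1`; the left edge of the cut square brings
  -- it down to `0`.
  have := (HasPattern.column (h' := fun _ => 0) h1 h2 c 0
    (by rw [stairHeight, hoff, if_neg (by omega), if_pos rfl]) ?_).2
  · rwa [sup_assoc, sup_assoc, ← sup_assoc (singleEdge _ _), sup_sweepEdge_eq_rowEdge w c hc] at this
  · funext q
    have hq : q = c ↔ cyclicOffset (finRotate (2 * n) c) q = 2 * n - 1 := by
      rw [← (cyclicOffset_injective (finRotate (2 * n) c)).eq_iff, hoff]
    have := cyclicOffset_lt (finRotate (2 * n) c) q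
    simp only [stairHeight, Function.update_apply, hq]
    split_ifs <;> omega

/-- The pattern below a row all of whose coins show `true`. -/
theorem HasPattern.row_true {n : ℕ} {E : CylinderVertex n → CylinderVertex n → Prop}
    {π : NCMatching n} (hE : LivesAbove E fun _ => 2) (hp : HasPattern E (fun _ => 2) π.1) :
    HasPattern (E ⊔ RowEdge fun _ => true) (fun _ => 0)
      (rotateMatching (rotateMatching π)).1 := by
  intro i j
  -- Every path climbs diagonally, one column per level; the retraction follows it up to height `2`.
  rw [eqvGen_iff_of_retract (E := E) (fun x =>
    if x.2 = 0 then (finRotate (2 * n) (finRotate (2 * n) x.1), 2)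
    else if x.2 = 1 then (finRotate (2 * n) x.1, 2) else x) le_sup_left]
  · have := hp (finRotate (2 * n) (finRotate (2 * n) i)) (finRotate (2 * n) (finRotate (2 * n) j))
    simp only [(finRotate (2 * n)).injective.eq_iff] at this
    simp only [if_true, this, rotateMatching, rotateFun, Equiv.symm_apply_eq]
  · rintro ⟨k, r⟩
    have e1 : EqvGen (E ⊔ RowEdge fun _ => true) (k, 1) (finRotate (2 * n) k, 2) :=
      .rel _ _ (.inr ⟨k, .inr ⟨rfl, rfl⟩⟩)
    have e0 : EqvGen (E ⊔ RowEdge fun _ => true) (k, 0) (finRotate (2 * n) k, 1) :=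
      .rel _ _ (.inr ⟨k, .inl ⟨rfl, rfl⟩⟩)
    have e1' : EqvGen (E ⊔ RowEdge fun _ => true) (finRotate (2 * n) k, 1)
      (finRotate (2 * n) (finRotate (2 * n) k), 2) := .rel _ _ (.inr ⟨_, .inr ⟨rfl, rfl⟩⟩)
    split_ifs with h0 h1
    · simp only at h0; subst h0
      exact .trans _ _ _ e0 e1'
    · simp only at h1; subst h1
      exact e1
    · exact .refl _
  · rintro x y (hxy | ⟨k, hk⟩)
    · have h2 : 2 ≤ x.2 ∧ 2 ≤ y.2 := hE x y hxy
      rw [if_neg (by omega), if_neg (by omega), if_neg (by omega), if_neg (by omega)]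
      exact .rel _ _ hxy
    · rcases hk with ⟨rfl, rfl⟩ | ⟨rfl, rfl⟩ <;> simp [EqvGen.refl]

/-! ### The row map and its independence of the cut -/

open Classical in
/-- The map sending the pattern above a row with coins `w` to the pattern below it. -/
noncomputable def rowMap {n : ℕ} (w : Fin (2 * n) → Bool) (π : NCMatching n) : NCMatching n :=
  if h : ∃ c, w c = false then sweep w (finRotate (2 * n) h.choose) (2 * n - 1) π
  else rotateMatching (rotateMatching π)

theorem rowMap_true {n : ℕ} (π : NCMatching n) :
    rowMap (fun _ => true) π = rotateMatching (rotateMatching π) := by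
  simp [rowMap]

theorem HasPattern.rowMap {n : ℕ} {E : CylinderVertex n → CylinderVertex n → Prop}
    {π : NCMatching n} (hE : LivesAbove E fun _ => 2) (hp : HasPattern E (fun _ => 2) π.1)
    (w : Fin (2 * n) → Bool) : HasPattern (E ⊔ RowEdge w) (fun _ => 0) (rowMap w π).1 := by
  by_cases h : ∃ c, w c = false
  · rw [_root_.rowMap, dif_pos h]
    exact HasPattern.row hE hp w _ h.choose_spec
  · obtain rfl : w = fun _ => true := funext fun c => by simpa using fun hc => h ⟨c, hc⟩
    rw [rowMap_true]
    exact HasPattern.row_true hE hp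

/-- Every matching is realised at height `2`. -/
theorem exists_hasPattern {n : ℕ} (π : NCMatching n) :
    ∃ E : CylinderVertex n → CylinderVertex n → Prop,
      LivesAbove E (fun _ => 2) ∧ HasPattern E (fun _ => 2) π.1 := by
  refine ⟨fun x y => x.2 = 2 ∧ y.2 = 2 ∧ π.1 x.1 = y.1, fun x y h => ⟨h.1.ge, h.2.1.ge⟩,
    fun i j => ⟨fun h => ?_, ?_⟩⟩
  · have key : ∀ x y : CylinderVertex n,
        EqvGen (fun x y : CylinderVertex n => x.2 = 2 ∧ y.2 = 2 ∧ π.1 x.1 = y.1) x y →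
        x.1 = y.1 ∨ π.1 x.1 = y.1 := by
      intro x y h
      have inv := π.2.involutive
      induction h with
      | rel x y h => exact .inr h.2.2
      | refl x => exact .inl rfl
      | symm x y _ ih => grind
      | trans x y z _ _ ih1 ih2 => grind
    exact key _ _ h
  · rintro (rfl | h)
    · exact .refl _
    · exact .rel _ _ ⟨rfl, rfl, h⟩

/-- Sweeps cut at different `false` squares describe the same graph, and a graph has at most one
pattern. Since `π` is realised by some graph, the algebraic identity follows without manipulating
operators. -/
theorem rowMap_eq_sweep {n : ℕ} {w : Fin (2 * n) → Bool} {c : Fin (2 * n)} (hc : w c = false)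
    (π : NCMatching n) : rowMap w π = sweep w (finRotate (2 * n) c) (2 * n - 1) π := by
  obtain ⟨E, hE, hp⟩ := exists_hasPattern π
  exact (HasPattern.rowMap hE hp w).unique (HasPattern.row hE hp w c hc)

/-- The effect of all squares of a row except those at `k` and its successor. -/
def sweepRest {n : ℕ} (w : Fin (2 * n) → Bool) (k : Fin (2 * n)) (π : NCMatching n) :
    NCMatching n :=
  sweep w ((finRotate (2 * n))^[2] k) (2 * n - 2) π

theorem sweepRest_congr {n : ℕ} {w w' : Fin (2 * n) → Bool} {k : Fin (2 * n)}
    (h : ∀ i, i ≠ k → i ≠ finRotate (2 * n) k → w i = w' i) (π : NCMatching n) :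
    sweepRest w k π = sweepRest w' k π := by
  refine sweep_congr (fun i hi => ?_) π
  rw [← Function.iterate_add_apply]
  apply h
  · intro e
    have := (iterate_finRotate_eq_iff k (i := i + 2) (j := 0) (by omega) (by omega)).1 e
    omega
  · intro e
    have := (iterate_finRotate_eq_iff k (i := i + 2) (j := 1) (by omega) (by omega)).1 e
    omega

/-- Cutting at `k + 1` puts the square at `k` last in the product. -/
theorem rowMap_of_succ_eq_false {n : ℕ} {w : Fin (2 * n) → Bool} {k : Fin (2 * n)}
    (h : w (finRotate (2 * n) k) = false) (π : NCMatching n) :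
    rowMap w π = coinStep (w k) k (sweepRest w k π) := by
  have hn := k.isLt
  have hk : (finRotate (2 * n))^[2 * n - 2] ((finRotate (2 * n))^[2] k) = k := by
    rw [← Function.iterate_add_apply, Nat.sub_add_cancel (by omega), iterate_finRotate_two_mul]
  rw [rowMap_eq_sweep h, show 2 * n - 1 = 2 * n - 2 + 1 by omega, sweep]
  change coinStep (w ((finRotate (2 * n))^[2 * n - 2] ((finRotate (2 * n))^[2] k)))
    ((finRotate (2 * n))^[2 * n - 2] ((finRotate (2 * n))^[2] k)) _ = _
  rw [hk]
  rfl

/-- Cutting at `k` puts the square at `k + 1` first in the product. -/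
theorem rowMap_of_eq_false {n : ℕ} {w : Fin (2 * n) → Bool} {k : Fin (2 * n)}
    (h : w k = false) (π : NCMatching n) :
    rowMap w π = sweepRest w k
      (coinStep (w (finRotate (2 * n) k)) (finRotate (2 * n) k) π) := by
  have hn := k.isLt
  rw [rowMap_eq_sweep h, show 2 * n - 1 = 1 + (2 * n - 2) by omega, sweep_add]
  rfl

/-- Cutting at a third square `c` puts the factors at `k` and `k + 1` next to each other: first the
squares after `c` up to `k - 1`, then `k` and `k + 1`, then those from `k + 2` to `c - 1`. -/
theorem rowMap_split {n : ℕ} {w : Fin (2 * n) → Bool} {k c : Fin (2 * n)} {d : ℕ}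
    (hd : d + 2 < 2 * n) (hdc : (finRotate (2 * n))^[d + 2] k = c) (h : w c = false)
    (π : NCMatching n) :
    rowMap w π = sweep w ((finRotate (2 * n))^[2] k) d
      (coinStep (w (finRotate (2 * n) k)) (finRotate (2 * n) k)
        (coinStep (w k) k (sweep w (finRotate (2 * n) c) (2 * n - 3 - d) π))) := by
  have hk : (finRotate (2 * n))^[2 * n - 3 - d] (finRotate (2 * n) c) = k := by
    rw [← hdc, ← Function.iterate_succ_apply' (finRotate (2 * n)), ← Function.iterate_add_apply,
      show 2 * n - 3 - d + (d + 2).succ = 2 * n by omega, iterate_finRotate_two_mul]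
  rw [rowMap_eq_sweep h, show 2 * n - 1 = 2 * n - 3 - d + (2 + d) by omega, sweep_add, hk,
    sweep_add]
  rfl

theorem temperleyLieb_rowMap_of_true_true {n : ℕ} {w : Fin (2 * n) → Bool} {k c : Fin (2 * n)}
    (hck : c ≠ k) (hcl : c ≠ finRotate (2 * n) k) (hc : w c = false) (hk : w k = true)
    (hl : w (finRotate (2 * n) k) = true) (π : NCMatching n) :
    temperleyLieb k (rowMap w π) = temperleyLieb k (sweepRest w k π) ∧
      rowMap w (temperleyLieb (finRotate (2 * n) k) π) =
        sweepRest w k (temperleyLieb (finRotate (2 * n) k) π) := by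
  have hn := k.isLt
  obtain ⟨d, hd, hdc⟩ : ∃ d, d + 2 < 2 * n ∧ (finRotate (2 * n))^[d + 2] k = c := by
    have h1 := cyclicOffset_lt k c
    have h2 := iterate_cyclicOffset k c
    obtain h | h | h : cyclicOffset k c = 0 ∨ cyclicOffset k c = 1 ∨ 2 ≤ cyclicOffset k c := by
      omega
    · rw [h] at h2; exact absurd h2.symm hck
    · rw [h] at h2; exact absurd h2.symm hcl
    · exact ⟨cyclicOffset k c - 2, by omega, by rwa [Nat.sub_add_cancel h]⟩
  have hkk : finRotate (2 * n) (finRotate (2 * n) k) ≠ k := fun e => by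
    have := (iterate_finRotate_eq_iff k (i := 2) (j := 0) (by omega) (by omega)).1 e
    omega
  have hne := finRotate_two_mul_ne k
  have commB : ∀ w' : Fin (2 * n) → Bool, ∀ π : NCMatching n,
      sweep w' ((finRotate (2 * n))^[2] k) d (temperleyLieb k π) =
      temperleyLieb k (sweep w' ((finRotate (2 * n))^[2] k) d π) := by
    intro w'
    refine sweep_comm fun i hi => ?_
    rw [← Function.iterate_add_apply, ← Function.iterate_add_apply]
    refine ⟨fun e => ?_, fun e => ?_, fun e => ?_⟩
    · have := (iterate_finRotate_eq_iff k (i := i + 2) (j := 0) (by omega) (by omega)).1 e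
      omega
    · have := (iterate_finRotate_eq_iff k (i := i + 1 + 2) (j := 0) (by omega) (by omega)).1 e
      omega
    · have := (iterate_finRotate_eq_iff k (i := i + 2) (j := 1) (by omega) (by omega)).1 e
      omega
  have commA : ∀ w' : Fin (2 * n) → Bool, ∀ π : NCMatching n,
      sweep w' (finRotate (2 * n) c) (2 * n - 3 - d) (temperleyLieb (finRotate (2 * n) k) π) =
      temperleyLieb (finRotate (2 * n) k) (sweep w' (finRotate (2 * n) c) (2 * n - 3 - d) π) := by
    intro w'
    have hc' : finRotate (2 * n) c = (finRotate (2 * n))^[d + 2] (finRotate (2 * n) k) := by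
      rw [← hdc, ← Function.iterate_succ_apply' (finRotate (2 * n)),
        ← Function.iterate_succ_apply (finRotate (2 * n))]
    rw [hc']
    generalize finRotate (2 * n) k = l
    refine sweep_comm fun i hi => ?_
    rw [← Function.iterate_add_apply, ← Function.iterate_add_apply]
    refine ⟨fun e => ?_, fun e => ?_, fun e => ?_⟩
    · have := (iterate_finRotate_eq_iff l (i := i + (d + 2)) (j := 0) (by omega) (by omega)).1 e
      omega
    · have := (iterate_finRotate_eq_iff l (i := i + 1 + (d + 2)) (j := 0)
        (by omega) (by omega)).1 e
      omega
    · have := (iterate_finRotate_eq_iff l (i := i + (d + 2)) (j := 1) (by omega) (by omega)).1 e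
      omega
  have split := fun (w' : Fin (2 * n) → Bool) (h' : ∀ i, i ≠ k → i ≠ finRotate (2 * n) k → w' i = w i)
      (π : NCMatching n) => rowMap_split (w := w') hd hdc ((h' c hck hcl).trans hc) π
  have hA : ∀ w' : Fin (2 * n) → Bool, (∀ i, i ≠ k → i ≠ finRotate (2 * n) k → w' i = w i) →
      ∀ π : NCMatching n, sweep w' (finRotate (2 * n) c) (2 * n - 3 - d) π =
        sweep w (finRotate (2 * n) c) (2 * n - 3 - d) π := by
    intro w' h'
    refine sweep_congr fun i hi => ?_
    rw [← hdc, ← Function.iterate_succ_apply' (finRotate (2 * n)), ← Function.iterate_add_apply]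
    refine h' _ (fun e => ?_) (fun e => ?_)
    · have := (iterate_finRotate_eq_iff k (i := i + (d + 2).succ) (j := 0)
        (by omega) (by omega)).1 e
      omega
    · have := (iterate_finRotate_eq_iff k (i := i + (d + 2).succ) (j := 1)
        (by omega) (by omega)).1 e
      omega
  have hB : ∀ w' : Fin (2 * n) → Bool, (∀ i, i ≠ k → i ≠ finRotate (2 * n) k → w' i = w i) →
      ∀ π : NCMatching n, sweep w' ((finRotate (2 * n))^[2] k) d π =
        sweep w ((finRotate (2 * n))^[2] k) d π := by
    intro w' h'
    refine sweep_congr fun i hi => ?_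
    rw [← Function.iterate_add_apply]
    refine h' _ (fun e => ?_) (fun e => ?_)
    · have := (iterate_finRotate_eq_iff k (i := i + 2) (j := 0) (by omega) (by omega)).1 e
      omega
    · have := (iterate_finRotate_eq_iff k (i := i + 2) (j := 1) (by omega) (by omega)).1 e
      omega
  constructor
  · have h' : ∀ i, i ≠ k → i ≠ finRotate (2 * n) k →
        Function.update w (finRotate (2 * n) k) false i = w i :=
      fun i _ hi => Function.update_of_ne hi _ _
    -- With the coin at `k + 1` turned to `false`, the row can be cut at `c` or at `k + 1`;
    -- comparing the two gives `B e_k A = e_k ∘ sweepRest`.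
    have e1 := rowMap_of_succ_eq_false (w := Function.update w (finRotate (2 * n) k) false) (k := k)
      (Function.update_self _ _ _) π
    rw [split _ h', hA _ h', hB _ h', Function.update_self, Function.update_of_ne hne.symm, hk,
      sweepRest_congr h'] at e1
    simp only [coinStep, if_true, Bool.false_eq_true, if_false] at e1
    rw [← e1, split w (fun _ _ _ => rfl), hk, hl]
    simp only [coinStep, if_true]
    rw [← commB, temperleyLieb_braid k hkk]
  · have h' : ∀ i, i ≠ k → i ≠ finRotate (2 * n) k → Function.update w k false i = w i :=
      fun i hi _ => Function.update_of_ne hi _ _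
    -- Likewise, cutting at `c` or at `k` gives `B e_{k+1} A = sweepRest ∘ e_{k+1}`.
    have e1 := rowMap_of_eq_false (w := Function.update w k false) (k := k)
      (Function.update_self _ _ _) π
    rw [split _ h', hA _ h', hB _ h', Function.update_self, Function.update_of_ne hne, hl,
      sweepRest_congr h'] at e1
    simp only [coinStep, if_true, Bool.false_eq_true, if_false] at e1
    rw [← e1, split w (fun _ _ _ => rfl), hk, hl]
    simp only [coinStep, if_true]
    rw [commA, temperleyLieb_braid' k hkk]

theorem sum_sum_update_bool {ι : Type*} [Fintype ι] [DecidableEq ι] (k : ι)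
    (H : (ι → Bool) → ℝ) :
    ∑ w, (H (Function.update w k true) + H (Function.update w k false)) = 2 * ∑ w, H w := by
  have hinv : Function.Involutive fun w : ι → Bool => Function.update w k (!w k) := by
    intro w
    simp
  have h2 : ∑ w, H (Function.update w k (!w k)) = ∑ w, H w :=
    Equiv.sum_comp hinv.toPerm H
  rw [two_mul]
  nth_rw 2 [← h2]
  rw [← Finset.sum_add_distrib]
  refine Finset.sum_congr rfl fun w _ => ?_
  have h := Function.update_eq_self k w
  cases hw : w k <;> rw [hw] at h <;> rw [h]
  · rw [Bool.not_false, add_comm]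
  · rw [Bool.not_true]

/-- Resampling two coordinates multiplies a sum over all configurations by `4`, so it suffices to
compare the sums over these two coins with the others frozen. -/
theorem sum_eq_sum_of_update_update {ι : Type*} [Fintype ι] [DecidableEq ι] (k l : ι)
    {H H' : (ι → Bool) → ℝ}
    (h : ∀ w, ∑ a, ∑ b, H (Function.update (Function.update w k a) l b) =
      ∑ a, ∑ b, H' (Function.update (Function.update w k a) l b)) :
    ∑ w, H w = ∑ w, H' w := by
  have key : ∀ H : (ι → Bool) → ℝ,
      ∑ w, ∑ a, ∑ b, H (Function.update (Function.update w k a) l b) = 4 * ∑ w, H w := by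
    intro H
    simp only [Fintype.sum_bool]
    rw [sum_sum_update_bool k fun w => H (Function.update w l true) + H (Function.update w l false),
      sum_sum_update_bool l H]
    ring
  have := Finset.sum_congr (rfl : (Finset.univ : Finset (ι → Bool)) = _) fun w _ => h w
  rw [key, key] at this
  linarith

open Classical in
/-- The coefficient with which a row enters the telescoping sum for the commutator: a row with
exactly one coin `false` counts less. -/
noncomputable def rowWeight {n : ℕ} (w : Fin (2 * n) → Bool) : ℝ :=
  if ∃ c, ∀ i, w i = false ↔ i = c then 2 else 3

theorem rowWeight_update {n : ℕ} (w : Fin (2 * n) → Bool) {k l : Fin (2 * n)} (hkl : k ≠ l) :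
    (rowWeight (Function.update (Function.update w k true) l false) =
      if ∀ i, i ≠ k → i ≠ l → w i = true then 2 else 3) ∧
    (rowWeight (Function.update (Function.update w k false) l true) =
      if ∀ i, i ≠ k → i ≠ l → w i = true then 2 else 3) := by
  constructor <;> unfold rowWeight <;> congr 1 <;> apply propext <;> constructor
  · rintro ⟨c, hc⟩ i hik hil
    have h1 := hc l
    have h2 := hc i
    grind
  · intro h
    refine ⟨l, fun i => ?_⟩
    have := h i
    grind
  · rintro ⟨c, hc⟩ i hik hil
    have h1 := hc k
    have h2 := hc i
    grind
  · intro h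
    refine ⟨k, fun i => ?_⟩
    have := h i
    grind

/-- Freeze the other coins and put `R = sweepRest w k`. The coins (true, false) give the row `e_k
R`, (false, true) gives `R e_{k+1}`, and (false, false) gives `R`. The mixed terms `e_k R e_{k+1}`
cancel, leaving `e_k R - R e_{k+1}` twice, and a third time from (true, true) unless that row is
entirely `true`. This count of two or three is `rowWeight`. -/
theorem sum_commutator_local {n : ℕ} (F : NCMatching n → ℝ) (π : NCMatching n) (k : Fin (2 * n)) :
    ∑ w : Fin (2 * n) → Bool, (if ∀ i, w i = true then 0 else F (temperleyLieb k (rowMap w π)) -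
        F (rowMap w (temperleyLieb (finRotate (2 * n) k) π))) =
      ∑ w : Fin (2 * n) → Bool, rowWeight w * F (rowMap w π) *
        ((if w k then 1 else 0) - if w (finRotate (2 * n) k) then 1 else 0) := by
  have hne := finRotate_two_mul_ne k
  apply sum_eq_sum_of_update_update k (finRotate (2 * n) k)
  intro w
  obtain ⟨w1, w2⟩ := rowWeight_update w hne.symm
  have hrest : ∀ a b, ∀ π, sweepRest
      (Function.update (Function.update w k a) (finRotate (2 * n) k) b) k π = sweepRest w k π :=
    fun a b => sweepRest_congr fun i h1 h2 => by
      rw [Function.update_of_ne h2, Function.update_of_ne h1]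
  have vk : ∀ a b, Function.update (Function.update w k a) (finRotate (2 * n) k) b k = a :=
    fun a b => by rw [Function.update_of_ne hne.symm, Function.update_self]
  have vl : ∀ a b, Function.update (Function.update w k a) (finRotate (2 * n) k) b
      (finRotate (2 * n) k) = b := fun a b => Function.update_self _ _ _
  have r1 : ∀ a π, rowMap (Function.update (Function.update w k a) (finRotate (2 * n) k) false) π =
      coinStep a k (sweepRest w k π) := fun a π => by
    rw [rowMap_of_succ_eq_false (vl a false), vk, hrest]
  have r2 : ∀ b π, rowMap (Function.update (Function.update w k false) (finRotate (2 * n) k) b) π =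
      sweepRest w k (coinStep b (finRotate (2 * n) k) π) := fun b π => by
    rw [rowMap_of_eq_false (vk false b), vl, hrest]
  have hF : ∀ a b, (a = false ∨ b = false) →
      ¬ ∀ i, Function.update (Function.update w k a) (finRotate (2 * n) k) b i = true := by
    rintro a b (rfl | rfl) h
    · have := h k
      rw [vk] at this
      simp at this
    · have := h (finRotate (2 * n) k)
      rw [vl] at this
      simp at this
  simp only [Fintype.sum_bool, vk, vl]
  rw [if_neg (hF true false (.inr rfl)), if_neg (hF false true (.inl rfl)),
    if_neg (hF false false (.inl rfl)), w1, w2, r1 true, r1 true, r2 true, r2 true, r1 false,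
    r2 false]
  simp only [coinStep, if_true, Bool.false_eq_true, if_false, temperleyLieb_idem, sub_self,
    mul_zero]
  -- If the other coins are all `true`, the choice (true, true) is the excluded row; otherwise a
  -- `false` elsewhere makes the cut used for two adjacent `true` coins available.
  by_cases hall : ∀ i, i ≠ k → i ≠ finRotate (2 * n) k → w i = true
  · rw [if_pos hall, if_pos]
    · ring
    · intro i
      simp only [Function.update_apply]
      grind
  · rw [if_neg hall, if_neg]
    · push Not at hall
      obtain ⟨c, hck, hcl, hc⟩ := hall
      have := temperleyLieb_rowMap_of_true_true
        (w := Function.update (Function.update w k true) (finRotate (2 * n) k) true) hck hcl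
        (by rw [Function.update_of_ne hcl, Function.update_of_ne hck]; simpa using hc)
        (vk _ _) (vl _ _) π
      rw [this.1, this.2, hrest, hrest]
      ring
    · intro h
      apply hall
      intro i hi hi'
      have := h i
      rwa [Function.update_of_ne hi', Function.update_of_ne hi] at this

/-- The Temperley-Lieb Hamiltonian commutes with the transfer operator of a row. -/
theorem sum_temperleyLieb_rowMap {n : ℕ} (F : NCMatching n → ℝ) (π : NCMatching n) :
    ∑ w : Fin (2 * n) → Bool, ∑ k, F (temperleyLieb k (rowMap w π)) =
      ∑ w : Fin (2 * n) → Bool, ∑ k, F (rowMap w (temperleyLieb k π)) := by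
  have hrot : ∀ w : Fin (2 * n) → Bool, ∑ k, F (rowMap w (temperleyLieb k π)) =
      ∑ k, F (rowMap w (temperleyLieb (finRotate (2 * n) k) π)) := fun w =>
    (Equiv.sum_comp (finRotate (2 * n)) fun k => F (rowMap w (temperleyLieb k π))).symm
  rw [← sub_eq_zero, ← Finset.sum_sub_distrib]
  -- The row of all `true` is a rotation by two steps, which merely permutes the `e_k`.
  have htrue : ∀ w : Fin (2 * n) → Bool, (∀ i, w i = true) →
      ∑ k, F (temperleyLieb k (rowMap w π)) - ∑ k, F (rowMap w (temperleyLieb k π)) = 0 := by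
    intro w hw
    obtain rfl : w = fun _ => true := funext hw
    rw [hrot, ← Equiv.sum_comp (finRotate (2 * n)) fun k =>
      F (rowMap _ (temperleyLieb (finRotate (2 * n) k) π)), sub_eq_zero]
    simp only [rowMap_true, rotateMatching_temperleyLieb]
  calc _ = ∑ w : Fin (2 * n) → Bool, ∑ k, (if ∀ i, w i = true then 0 else
        F (temperleyLieb k (rowMap w π)) -
        F (rowMap w (temperleyLieb (finRotate (2 * n) k) π))) := by
        refine Finset.sum_congr rfl fun w _ => ?_
        by_cases hw : ∀ i, w i = true
        · rw [htrue w hw]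
          simp [hw]
        · rw [hrot w, ← Finset.sum_sub_distrib]
          simp only [if_neg hw]
    _ = ∑ k, ∑ w : Fin (2 * n) → Bool, rowWeight w * F (rowMap w π) *
        ((if w k then 1 else 0) - if w (finRotate (2 * n) k) then 1 else 0) := by
        rw [Finset.sum_comm]
        exact Finset.sum_congr rfl fun k _ => sum_commutator_local F π k
    _ = 0 := by
        rw [Finset.sum_comm]
        refine Finset.sum_eq_zero fun w _ => ?_
        rw [← Finset.mul_sum, Finset.sum_sub_distrib,
          Equiv.sum_comp (finRotate (2 * n)) fun k => if w k then (1 : ℝ) else 0, sub_self,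
          mul_zero]

/-! ### Separating the lowest row from the rest -/

/-- The configuration of the rows above the lowest one. -/
def shiftConfig {n : ℕ} (ω : CylinderConfig n) : CylinderConfig n := fun x => ω (x.1, x.2 + 1)

/-- The coins of the lowest row. -/
def bottomRow {n : ℕ} (ω : CylinderConfig n) : Fin (2 * n) → Bool := fun c => ω (c, 0)

theorem reachable_loopGraph_iff {n : ℕ} (ω : CylinderConfig n) (x y : CylinderVertex n) :
    (loopGraph ω).Reachable x y ↔ EqvGen (LoopEdge ω) x y := by
  rw [SimpleGraph.reachable_iff_reflTransGen]
  constructor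
  · intro h
    induction h with
    | refl => exact .refl _
    | tail _ h ih =>
      refine .trans _ _ _ ih ?_
      rcases ((SimpleGraph.fromRel_adj _ _ _).1 h).2 with h | h
      · exact .rel _ _ h
      · exact .symm _ _ (.rel _ _ h)
  · intro h
    rw [← SimpleGraph.reachable_iff_reflTransGen]
    induction h with
    | rel x y h =>
      by_cases hxy : x = y
      · rw [hxy]
      · exact ((SimpleGraph.fromRel_adj _ _ _).2 ⟨hxy, .inl h⟩).reachable
    | refl x => rfl
    | symm x y _ ih => exact ih.symm
    | trans x y z _ _ ih1 ih2 => exact ih1.trans ih2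

theorem mem_connectivityEvent_iff {n : ℕ} (ω : CylinderConfig n) (π : NCMatching n) :
    ω ∈ connectivityEvent π ↔ HasPattern (LoopEdge ω) (fun _ => 0) π.1 := by
  simp only [connectivityEvent, Set.mem_ofPred_eq, PathMatched, HasPattern, reachable_loopGraph_iff]
  refine forall_congr' fun i => forall_congr' fun j => ?_
  have ne := π.2.ne_self i
  by_cases hij : i = j
  · subst hij
    simp [ne, EqvGen.refl]
  · simp [hij]

/-- The relation `E` moved up by one row of white squares. -/
def liftEdge {n : ℕ} (E : CylinderVertex n → CylinderVertex n → Prop)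
    (x y : CylinderVertex n) : Prop :=
  2 ≤ x.2 ∧ 2 ≤ y.2 ∧ E (x.1, x.2 - 2) (y.1, y.2 - 2)

theorem livesAbove_liftEdge {n : ℕ} (E : CylinderVertex n → CylinderVertex n → Prop) :
    LivesAbove (liftEdge E) fun _ => 2 := fun _ _ h => ⟨h.1, h.2.1⟩

theorem hasPattern_liftEdge {n : ℕ} {E : CylinderVertex n → CylinderVertex n → Prop}
    {π : Fin (2 * n) → Fin (2 * n)} (h : HasPattern E (fun _ => 0) π) :
    HasPattern (liftEdge E) (fun _ => 2) π := by
  intro i j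
  rw [← h i j]
  constructor
  · exact fun h => eqvGen_map (fun x : CylinderVertex n => ((x.1, x.2 - 2) : CylinderVertex n))
      (fun x y hxy => .rel _ _ hxy.2.2) h
  · exact fun h => eqvGen_map (fun x : CylinderVertex n => ((x.1, x.2 + 2) : CylinderVertex n))
      (fun x y hxy => .rel _ _ ⟨by simp, by simp, by simpa using hxy⟩) h

theorem loopEdge_eq {n : ℕ} (ω : CylinderConfig n) :
    LoopEdge ω = liftEdge (LoopEdge (shiftConfig ω)) ⊔ RowEdge (bottomRow ω) := by
  funext x y
  apply propext
  constructor
  · intro h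
    cases h with
    | bottom c s h =>
      cases s with
      | zero => exact .inr ⟨c, by simp [bottomRow, h, SquareEdge, singleEdge]⟩
      | succ s => exact .inl ⟨by dsimp only; omega, by dsimp only; omega,
          LoopEdge.bottom (ω := shiftConfig ω) c s h⟩
    | top c s h =>
      cases s with
      | zero => exact .inr ⟨c, by simp [bottomRow, h, SquareEdge, singleEdge]⟩
      | succ s => exact .inl ⟨by dsimp only; omega, by dsimp only; omega,
          LoopEdge.top (ω := shiftConfig ω) c s h⟩
    | left c s h =>
      cases s with
      | zero => exact .inr ⟨c, by simp [bottomRow, h, SquareEdge, singleEdge]⟩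
      | succ s => exact .inl ⟨by dsimp only; omega, by dsimp only; omega,
          LoopEdge.left (ω := shiftConfig ω) c s h⟩
    | right c s h =>
      cases s with
      | zero => exact .inr ⟨c, by simp [bottomRow, h, SquareEdge, singleEdge]⟩
      | succ s => exact .inl ⟨by dsimp only; omega, by dsimp only; omega,
          LoopEdge.right (ω := shiftConfig ω) c s h⟩
  · rintro (⟨hx, hy, h⟩ | ⟨c, h⟩)
    · obtain ⟨a, r⟩ := x
      obtain ⟨b, s⟩ := y
      obtain ⟨r, rfl⟩ := Nat.exists_eq_add_of_le' hx
      obtain ⟨s, rfl⟩ := Nat.exists_eq_add_of_le' hy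
      simp only [Nat.add_sub_cancel] at h
      generalize hu : ((a, r) : CylinderVertex n) = u at h
      generalize hv : ((b, s) : CylinderVertex n) = v at h
      cases h <;> (obtain ⟨rfl, rfl⟩ := Prod.mk.inj hu; obtain ⟨rfl, rfl⟩ := Prod.mk.inj hv)
      · rename_i s h
        exact LoopEdge.bottom (ω := ω) _ (s + 1) h
      · rename_i s h
        exact LoopEdge.top (ω := ω) _ (s + 1) h
      · rename_i s h
        exact LoopEdge.left (ω := ω) _ (s + 1) h
      · rename_i c s h
        exact LoopEdge.right (ω := ω) c (s + 1) h
    · cases hc : bottomRow ω c with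
      | true =>
        rw [hc] at h
        rcases h with ⟨rfl, rfl⟩ | ⟨rfl, rfl⟩
        · exact LoopEdge.bottom c 0 hc
        · exact LoopEdge.top c 0 hc
      | false =>
        rw [hc] at h
        rcases h with ⟨rfl, rfl⟩ | ⟨rfl, rfl⟩
        · exact LoopEdge.right c 0 hc
        · exact LoopEdge.left c 0 hc

theorem mem_connectivityEvent_rowMap {n : ℕ} {ω : CylinderConfig n} {π : NCMatching n}
    (h : shiftConfig ω ∈ connectivityEvent π) : ω ∈ connectivityEvent (rowMap (bottomRow ω) π) := by
  rw [mem_connectivityEvent_iff] at h ⊢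
  rw [loopEdge_eq]
  exact HasPattern.rowMap (livesAbove_liftEdge _) (hasPattern_liftEdge h) _

theorem connectivityEvent_unique {n : ℕ} {ω : CylinderConfig n} {π π' : NCMatching n}
    (h : ω ∈ connectivityEvent π) (h' : ω ∈ connectivityEvent π') : π = π' := by
  rw [mem_connectivityEvent_iff] at h h'
  exact h.unique h'

/-! ### The alternating row -/

/-- The matching of `1` with `2`, of `3` with `4`, and so on. -/
def adjacentPairing (n : ℕ) : NCMatching n :=
  ⟨fun i => if h : (i : ℕ) % 2 = 0 then ⟨i + 1, by omega⟩ else ⟨i - 1, by omega⟩, by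
    refine ⟨fun k => ?_, fun k hk => ?_, ?_⟩
    · apply Fin.ext
      split_ifs with h1 h2 h2 <;> simp at h2 ⊢ <;> omega
    · have := congrArg Fin.val hk
      split_ifs at this <;> simp at this <;> omega
    · rintro ⟨a, b, c, d, hab, hbc, hcd, hc, hd⟩
      have hc' := congrArg Fin.val hc
      rw [Fin.lt_def] at hab hbc
      split_ifs at hc' <;> simp at hc' <;> omega⟩

/-- The row whose coins show `true` and `false` alternately. -/
def alternatingRow (n : ℕ) : Fin (2 * n) → Bool := fun i => (i : ℕ) % 2 = 0

/-- The points `2i` and `2i + 1` of `Fin (2 * n)` are joined through the single vertex `(2i + 1,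
1)`, so no boundary path leaves the row. Nothing is required of the pattern of `E`, not even that it
exists. -/
theorem hasPattern_alternatingRow {n : ℕ} {E : CylinderVertex n → CylinderVertex n → Prop}
    (hE : LivesAbove E fun _ => 2) :
    HasPattern (E ⊔ RowEdge (alternatingRow n)) (fun _ => 0) (adjacentPairing n).1 := by
  intro i j
  constructor
  · intro h
    -- A label constant on components: `i + 1` on the three vertices of the arc joining columns `2i`
    -- and `2i + 1`, and `0` elsewhere.
    have key := eqvGen_map (E' := fun _ _ : ℕ => False) (fun x : CylinderVertex n =>
      if x.2 = 0 ∨ (x.2 = 1 ∧ (x.1 : ℕ) % 2 = 1) then (x.1 : ℕ) / 2 + 1 else 0) ?_ h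
    · have key' := (eqvGen_iff_eq_of_isolated (fun _ => ⟨not_false, not_false⟩) _).1 key
      simp only [true_or, if_true] at key'
      simp only [adjacentPairing, Fin.ext_iff]
      split_ifs <;> dsimp only <;> omega
    · rintro x y (hxy | ⟨k, hk⟩)
      · have h2 : 2 ≤ x.2 ∧ 2 ≤ y.2 := hE x y hxy
        rw [if_neg (by omega), if_neg (by omega)]
        exact .refl _
      · have hr := val_finRotate_two_mul k
        have hklt := k.isLt
        by_cases hk2 : (k : ℕ) % 2 = 0
        · rw [SquareEdge, if_pos (by simp [alternatingRow, hk2])] at hk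
          rcases hk with ⟨rfl, rfl⟩ | ⟨rfl, rfl⟩ <;> dsimp only
          · rw [if_neg (by omega)] at hr
            rw [if_pos (by simp), if_pos (by omega), hr, show ((k : ℕ) + 1) / 2 = k / 2 by omega]
            exact .refl _
          · rw [if_neg (by omega), if_neg (by omega)]
            exact .refl _
        · rw [SquareEdge, if_neg (by simp [alternatingRow, hk2])] at hk
          rcases hk with ⟨rfl, rfl⟩ | ⟨rfl, rfl⟩ <;> dsimp only
          · rw [if_neg (by split_ifs at hr <;> omega), if_neg (by omega)]
            exact .refl _
          · rw [if_pos (by omega), if_pos (by omega)]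
            exact .refl _
  · have key : ∀ i j : Fin (2 * n), (i : ℕ) % 2 = 0 → (j : ℕ) = i + 1 →
        EqvGen (E ⊔ RowEdge (alternatingRow n)) (i, 0) (j, 0) := by
      intro i j hi hj
      have hr := val_finRotate_two_mul i
      have hij : finRotate (2 * n) i = j := by
        apply Fin.ext
        split_ifs at hr <;> omega
      have e1 : EqvGen (E ⊔ RowEdge (alternatingRow n)) (i, 0) (j, 1) := by
        refine .rel _ _ (.inr ⟨i, ?_⟩)
        rw [SquareEdge, if_pos (by simp [alternatingRow, hi]), hij]
        exact .inl ⟨rfl, rfl⟩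
      have e2 : EqvGen (E ⊔ RowEdge (alternatingRow n)) (j, 0) (j, 1) := by
        refine .rel _ _ (.inr ⟨j, ?_⟩)
        rw [SquareEdge, if_neg (by simp [alternatingRow]; omega)]
        exact .inr ⟨rfl, rfl⟩
      exact .trans _ _ _ e1 (.symm _ _ e2)
    rintro (rfl | h)
    · exact .refl _
    · have h' := congrArg Fin.val h
      simp only [adjacentPairing] at h'
      split_ifs at h' with hi <;> simp only at h'
      · exact key i j hi h'.symm
      · exact .symm _ _ (key j i (by omega) (by omega))

theorem mem_connectivityEvent_of_alternatingRow {n : ℕ} {ω : CylinderConfig n}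
    (h : bottomRow ω = alternatingRow n) : ω ∈ connectivityEvent (adjacentPairing n) := by
  rw [mem_connectivityEvent_iff, loopEdge_eq, h]
  exact hasPattern_alternatingRow (livesAbove_liftEdge _)

theorem rowMap_alternatingRow {n : ℕ} (π : NCMatching n) :
    rowMap (alternatingRow n) π = adjacentPairing n := by
  obtain ⟨E, hE, hp⟩ := exists_hasPattern π
  exact (HasPattern.rowMap hE hp _).unique (hasPattern_alternatingRow hE)

/-! ### Law of the rows and measurability -/

instance instIsProbabilityMeasureLoopMeasure (n : ℕ) : IsProbabilityMeasure (loopMeasure n) := by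
  unfold loopMeasure
  infer_instance

theorem coin_singleton (b : Bool) : (PMF.uniformOfFintype Bool).toMeasure {b} = 2⁻¹ := by
  rw [PMF.toMeasure_apply_singleton _ _ (measurableSet_singleton b)]
  simp

theorem measurable_shiftConfig {n : ℕ} : Measurable (shiftConfig (n := n)) :=
  measurable_pi_lambda _ fun _ => measurable_pi_apply _

theorem measurable_bottomRow {n : ℕ} : Measurable (bottomRow (n := n)) :=
  measurable_pi_lambda _ fun _ => measurable_pi_apply _

/-- The lowest row consists of fair coins and is independent of the rest of the configuration,
which has the same law as the whole. -/
theorem loopMeasure_bottomRow_inter_shiftConfig {n : ℕ} (w : Fin (2 * n) → Bool)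
    {B : Set (CylinderConfig n)} (hB : MeasurableSet B) :
    loopMeasure n (bottomRow ⁻¹' {w} ∩ shiftConfig ⁻¹' B) =
      2⁻¹ ^ (2 * n) * loopMeasure n B := by
  classical
  have h0 : (2⁻¹ : ENNReal) ^ (2 * n) ≠ 0 := by simp
  have h1 : (2⁻¹ : ENNReal) ^ (2 * n) ≠ ⊤ := ENNReal.pow_ne_top (by simp)
  -- The conditional law of the upper rows given the lowest one is identified as the product measure
  -- by its values on finite boxes.
  have key : ((2⁻¹ : ENNReal) ^ (2 * n))⁻¹ •
      ((loopMeasure n).restrict (bottomRow ⁻¹' {w})).map shiftConfig = loopMeasure n := by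
    apply Measure.eq_infinitePi
    intro s t ht
    have hs : MeasurableSet (Set.pi (s : Set (Fin (2 * n) × ℕ)) t) :=
      MeasurableSet.pi s.countable_toSet fun i _ => ht i
    rw [Measure.smul_apply, Measure.map_apply measurable_shiftConfig hs,
      Measure.restrict_apply (measurable_shiftConfig hs), smul_eq_mul]
    have up : Function.Injective fun x : Fin (2 * n) × ℕ => (x.1, x.2 + 1) := by
      rintro ⟨a, r⟩ ⟨b, s⟩ h
      simpa using h
    have row : Function.Injective fun c : Fin (2 * n) => (c, 0) := fun a b h => by simpa using h
    -- The box `t` moved up one row, together with the prescribed coins in row `0`, is again a box.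
    let t' : Fin (2 * n) × ℕ → Set Bool := fun x =>
      if x.2 = 0 then {w x.1} else t (x.1, x.2 - 1)
    have hset : shiftConfig ⁻¹' (Set.pi (s : Set (Fin (2 * n) × ℕ)) t) ∩ bottomRow ⁻¹' {w} =
        Set.pi ((s.image fun x => (x.1, x.2 + 1)) ∪ Finset.univ.image fun c => (c, 0) :
          Finset (Fin (2 * n) × ℕ)) t' := by
      ext ω
      simp only [Set.mem_inter_iff, Set.mem_preimage, Set.mem_pi, Set.mem_singleton_iff,
        funext_iff, Finset.coe_union, Finset.coe_image, Set.mem_union, or_imp, forall_and,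
        Set.forall_mem_image, t', shiftConfig, bottomRow]
      simp
    rw [hset, loopMeasure, Measure.infinitePi_pi]
    · rw [Finset.prod_union, Finset.prod_image (fun _ _ _ _ h => up h),
        Finset.prod_image (fun _ _ _ _ h => row h)]
      · simp only [t', Nat.add_eq_zero_iff, one_ne_zero, and_false, if_false, if_true,
          coin_singleton, Finset.prod_const, Finset.card_univ,
          Fintype.card_fin]
        rw [mul_comm (∏ _ ∈ _, _), ← mul_assoc, ENNReal.inv_mul_cancel h0 h1, one_mul]
        rfl
      · rw [Finset.disjoint_left]
        simp
        omega
    · intro i _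
      exact MeasurableSet.of_discrete
  have := congrArg (fun μ => μ B) key
  simp only [Measure.smul_apply, Measure.map_apply measurable_shiftConfig hB,
    Measure.restrict_apply (measurable_shiftConfig hB), smul_eq_mul] at this
  rw [← this, ← mul_assoc, ENNReal.mul_inv_cancel h0 h1, one_mul, Set.inter_comm]

theorem measurableSet_loopEdge {n : ℕ} (x y : CylinderVertex n) :
    MeasurableSet {ω : CylinderConfig n | LoopEdge ω x y} := by
  have h : ∀ (b : Bool) (c : Fin (2 * n)) (s : ℕ), MeasurableSet {ω : CylinderConfig n | ω (c, s) = b} :=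
    fun b c s => (measurable_pi_apply (X := fun _ => Bool) (c, s)) (measurableSet_singleton b)
  have : {ω : CylinderConfig n | LoopEdge ω x y} = ⋃ (c : Fin (2 * n)) (s : ℕ),
      ({ω | ω (c, s) = true} ∩ {_ω | (x = (c, 2 * s) ∧ y = (finRotate (2 * n) c, 2 * s + 1)) ∨
        (x = (c, 2 * s + 1) ∧ y = (finRotate (2 * n) c, 2 * s + 2))}) ∪
      ({ω | ω (c, s) = false} ∩ {_ω | (x = (c, 2 * s) ∧ y = (c, 2 * s + 1)) ∨
        (x = (finRotate (2 * n) c, 2 * s + 1) ∧ y = (finRotate (2 * n) c, 2 * s + 2))}) := by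
    ext ω
    simp only [Set.mem_iUnion, Set.mem_union, Set.mem_inter_iff, Set.mem_ofPred_eq]
    constructor
    · rintro (⟨c, s, h⟩ | ⟨c, s, h⟩ | ⟨c, s, h⟩ | ⟨c, s, h⟩) <;> exact ⟨c, s, by simp [h]⟩
    · rintro ⟨c, s, ⟨h, ⟨rfl, rfl⟩ | ⟨rfl, rfl⟩⟩ | ⟨h, ⟨rfl, rfl⟩ | ⟨rfl, rfl⟩⟩⟩
      · exact .bottom c s h
      · exact .top c s h
      · exact .left c s h
      · exact .right c s h
  rw [this]
  exact .iUnion fun c => .iUnion fun s =>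
    ((h _ c s).inter (.const _)).union ((h _ c s).inter (.const _))

/-- There are countably many vertices, so walks of a given length are handled by induction on the
length, with a countable union over the first step. -/
theorem measurableSet_reachable {n : ℕ} (x y : CylinderVertex n) :
    MeasurableSet {ω : CylinderConfig n | (loopGraph ω).Reachable x y} := by
  have hadj : ∀ x y : CylinderVertex n, MeasurableSet {ω | (loopGraph ω).Adj x y} := fun x y => by
    simp only [loopGraph, SimpleGraph.fromRel_adj]
    exact (MeasurableSet.const _).inter ((measurableSet_loopEdge x y).union
      (measurableSet_loopEdge y x))
  have hwalk : ∀ (m : ℕ) (x : CylinderVertex n),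
      MeasurableSet {ω | ∃ p : (loopGraph ω).Walk x y, p.length = m} := by
    intro m
    induction m with
    | zero =>
      intro x
      have : {ω : CylinderConfig n | ∃ p : (loopGraph ω).Walk x y, p.length = 0} =
          {_ω | x = y} := by
        ext ω
        simp only [Set.mem_ofPred_eq]
        constructor
        · rintro ⟨p, hp⟩
          exact SimpleGraph.Walk.eq_of_length_eq_zero hp
        · rintro rfl
          exact ⟨.nil, rfl⟩
      rw [this]
      exact .const _
    | succ m ih =>
      intro x
      have : {ω : CylinderConfig n | ∃ p : (loopGraph ω).Walk x y, p.length = m + 1} =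
          ⋃ z, {ω | (loopGraph ω).Adj x z} ∩
            {ω | ∃ p : (loopGraph ω).Walk z y, p.length = m} := by
        ext ω
        simp only [Set.mem_iUnion, Set.mem_inter_iff, Set.mem_ofPred_eq]
        constructor
        · rintro ⟨p, hp⟩
          cases p with
          | nil => simp at hp
          | cons h q => exact ⟨_, h, q, by simpa using hp⟩
        · rintro ⟨z, h, q, hq⟩
          exact ⟨.cons h q, by simp [hq]⟩
      rw [this]
      exact .iUnion fun z => (hadj x z).inter (ih z)
  have : {ω : CylinderConfig n | (loopGraph ω).Reachable x y} =
      ⋃ m, {ω | ∃ p : (loopGraph ω).Walk x y, p.length = m} := by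
    ext ω
    simp only [Set.mem_iUnion, Set.mem_ofPred_eq]
    exact ⟨fun ⟨p⟩ => ⟨_, p, rfl⟩, fun ⟨_, p, _⟩ => ⟨p⟩⟩
  rw [this]
  exact .iUnion fun m => hwalk m x

theorem measurableSet_connectivityEvent {n : ℕ} (π : NCMatching n) :
    MeasurableSet (connectivityEvent π) := by
  have : connectivityEvent π = ⋂ (i : Fin (2 * n)) (j : Fin (2 * n)), {ω | PathMatched ω i j ↔ π.1 i = j} := by
    ext ω
    simp [connectivityEvent]
  rw [this]
  refine .iInter fun i => .iInter fun j => ?_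
  have h : MeasurableSet {ω : CylinderConfig n | PathMatched ω i j} :=
    (MeasurableSet.const _).inter (measurableSet_reachable _ _)
  by_cases hij : π.1 i = j
  · simpa [hij] using h
  · simp only [hij, iff_false]
    exact h.compl

/-! ### Almost sure existence and stationarity of the pattern -/

/-- If there is no pattern, the lowest row is not alternating and the configuration above it has no
pattern either. By independence `P(U) ≤ (1 - 2^{-2n}) P(U)`, which forces `P(U) = 0`. -/
theorem loopMeasure_iUnion_connectivityEvent_compl (n : ℕ) :
    loopMeasure n (⋃ π : NCMatching n, connectivityEvent π)ᶜ = 0 := by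
  set U : Set (CylinderConfig n) := (⋃ π : NCMatching n, connectivityEvent π)ᶜ with hU
  have mU : MeasurableSet U :=
    (MeasurableSet.iUnion fun π => measurableSet_connectivityEvent π).compl
  have hsub : U ⊆ ⋃ w ∈ Finset.univ.erase (alternatingRow n),
      (bottomRow ⁻¹' {w} ∩ shiftConfig ⁻¹' U) := by
    intro ω hω
    simp only [hU, Set.mem_compl_iff, Set.mem_iUnion, not_exists] at hω
    simp only [Set.mem_iUnion]
    refine ⟨bottomRow ω, ?_, rfl, ?_⟩
    · rw [Finset.mem_erase]
      exact ⟨fun h => hω _ (mem_connectivityEvent_of_alternatingRow h), Finset.mem_univ _⟩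
    · simp only [hU, Set.mem_preimage, Set.mem_compl_iff, Set.mem_iUnion, not_exists]
      exact fun π hπ => hω _ (mem_connectivityEvent_rowMap hπ)
  have hle : loopMeasure n U ≤
      ∑ w ∈ Finset.univ.erase (alternatingRow n), 2⁻¹ ^ (2 * n) * loopMeasure n U := by
    refine (measure_mono hsub).trans ((measure_biUnion_finset_le _ _).trans ?_)
    exact Finset.sum_le_sum fun w _ => (loopMeasure_bottomRow_inter_shiftConfig w mU).le
  rw [Finset.sum_const, Finset.card_erase_of_mem (Finset.mem_univ _), Finset.card_univ] at hle
  have hfin : loopMeasure n U ≠ ⊤ := measure_ne_top _ _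
  have hreal := ENNReal.toReal_mono (by
    rw [nsmul_eq_mul]
    exact ENNReal.mul_ne_top (ENNReal.natCast_ne_top _)
      (ENNReal.mul_ne_top (ENNReal.pow_ne_top (by simp)) hfin)) hle
  simp only [Fintype.card_pi, Fintype.card_bool, Finset.prod_const, Finset.card_univ,
    Fintype.card_fin, nsmul_eq_mul, ENNReal.toReal_mul, ENNReal.toReal_pow, ENNReal.toReal_inv,
    ENNReal.toReal_natCast, ENNReal.toReal_ofNat] at hreal
  have hpos : (0 : ℝ) < 2 ^ (2 * n) := by positivity
  rw [Nat.cast_sub Nat.one_le_two_pow, inv_pow] at hreal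
  push_cast at hreal
  have h0 : (loopMeasure n U).toReal ≤ 0 := by
    have : ((2 : ℝ) ^ (2 * n) - 1) * ((2 ^ (2 * n))⁻¹ * (loopMeasure n U).toReal) =
        (loopMeasure n U).toReal - (2 ^ (2 * n))⁻¹ * (loopMeasure n U).toReal := by
      field_simp
    rw [this] at hreal
    have h3 : (2 ^ (2 * n) : ℝ)⁻¹ * (loopMeasure n U).toReal ≤ 0 := by linarith
    exact nonpos_of_mul_nonpos_right h3 (by positivity)
  exact (ENNReal.toReal_eq_zero_iff _).1 (le_antisymm h0 ENNReal.toReal_nonneg) |>.resolve_right hfin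

theorem sum_connectivityDistribution (n : ℕ) :
    ∑ π : NCMatching n, connectivityDistribution n π = 1 := by
  have h := measureReal_iUnion_fintype (μ := loopMeasure n)
    (f := fun π : NCMatching n => connectivityEvent π)
    (fun π π' hne => Set.disjoint_left.2 fun ω h h' => hne (connectivityEvent_unique h h'))
    (fun π => measurableSet_connectivityEvent π)
  unfold connectivityDistribution
  rw [← h, measureReal_def, (prob_compl_eq_zero_iff (MeasurableSet.iUnion fun π => measurableSet_connectivityEvent π)).1
    (loopMeasure_iUnion_connectivityEvent_compl n), ENNReal.toReal_one]

/-- The distribution of the pattern is stationary under the transfer operator of a row. -/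
theorem sum_connectivityDistribution_rowMap {n : ℕ} (F : NCMatching n → ℝ) :
    ∑ π, connectivityDistribution n π * ∑ w : Fin (2 * n) → Bool, F (rowMap w π) =
      2 ^ (2 * n) * ∑ π, connectivityDistribution n π * F π := by
  classical
  have hval : ∀ (w : Fin (2 * n) → Bool) (π : NCMatching n),
      (loopMeasure n).real (bottomRow ⁻¹' {w} ∩ shiftConfig ⁻¹' connectivityEvent π) =
      (2 ^ (2 * n))⁻¹ * connectivityDistribution n π := by
    intro w π
    rw [measureReal_def, loopMeasure_bottomRow_inter_shiftConfig w
      (measurableSet_connectivityEvent π), ENNReal.toReal_mul]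
    simp [connectivityDistribution, measureReal_def]
  have hstat : ∀ ρ : NCMatching n, connectivityDistribution n ρ =
      ∑ x : (Fin (2 * n) → Bool) × NCMatching n with rowMap x.1 x.2 = ρ,
        (2 ^ (2 * n))⁻¹ * connectivityDistribution n x.2 := by
    intro ρ
    have hU := loopMeasure_iUnion_connectivityEvent_compl n
    -- The equality is only almost sure: the event on the left may occur while the rows above have
    -- no pattern.
    have hae : connectivityEvent ρ =ᵐ[loopMeasure n]
        ⋃ x ∈ (Finset.univ.filter fun x : (Fin (2 * n) → Bool) × NCMatching n =>
          rowMap x.1 x.2 = ρ), (bottomRow ⁻¹' {x.1} ∩ shiftConfig ⁻¹' connectivityEvent x.2) := by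
      have hU' : loopMeasure n
          (shiftConfig ⁻¹' (⋃ π : NCMatching n, connectivityEvent π)ᶜ) = 0 := by
        have mU : MeasurableSet (⋃ π : NCMatching n, connectivityEvent π)ᶜ :=
          (MeasurableSet.iUnion fun π => measurableSet_connectivityEvent π).compl
        refine measure_mono_null (t := ⋃ w : Fin (2 * n) → Bool, bottomRow ⁻¹' {w} ∩
          shiftConfig ⁻¹' (⋃ π : NCMatching n, connectivityEvent π)ᶜ) ?_ ?_
        · intro ω hω
          exact Set.mem_iUnion.2 ⟨bottomRow ω, rfl, hω⟩
        · refine measure_iUnion_null fun w => ?_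
          rw [loopMeasure_bottomRow_inter_shiftConfig w mU, hU, mul_zero]
      have hev : ∀ᵐ ω ∂loopMeasure n,
          shiftConfig ω ∈ ⋃ π : NCMatching n, connectivityEvent π := by
        rw [ae_iff]
        exact hU'
      filter_upwards [hev] with ω hω
      obtain ⟨π, hπ⟩ := Set.mem_iUnion.1 hω
      have hπ' := mem_connectivityEvent_rowMap hπ
      apply propext
      change ω ∈ connectivityEvent ρ ↔ ω ∈ ⋃ x ∈ _, _
      simp only [Set.mem_iUnion, Finset.mem_filter, Finset.mem_univ, true_and, exists_prop]
      constructor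
      · intro h
        exact ⟨(bottomRow ω, π), connectivityEvent_unique hπ' h, rfl, hπ⟩
      · rintro ⟨⟨w, π'⟩, h1, h2, h3⟩
        obtain rfl : bottomRow ω = w := h2
        obtain rfl : rowMap (bottomRow ω) π' = ρ := h1
        exact mem_connectivityEvent_rowMap h3
    rw [connectivityDistribution, measureReal_congr hae, measureReal_biUnion_finset]
    · exact Finset.sum_congr rfl fun x _ => hval x.1 x.2
    · intro x _ y _ hxy
      refine Set.disjoint_left.2 fun ω hx hy => hxy (Prod.ext ?_ ?_)
      · exact (hx.1 : bottomRow ω = x.1).symm.trans hy.1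
      · exact connectivityEvent_unique hx.2 hy.2
    · intro x _
      exact (measurable_bottomRow (measurableSet_singleton _)).inter
        (measurable_shiftConfig (measurableSet_connectivityEvent _))
  have h1 : ∑ ρ, connectivityDistribution n ρ * F ρ =
      ∑ x : (Fin (2 * n) → Bool) × NCMatching n,
        (2 ^ (2 * n))⁻¹ * connectivityDistribution n x.2 * F (rowMap x.1 x.2) := by
    rw [← Finset.sum_fiberwise (s := Finset.univ) (g := fun x : (Fin (2 * n) → Bool) × NCMatching n => rowMap x.1 x.2)]
    refine Finset.sum_congr rfl fun ρ _ => ?_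
    rw [hstat ρ, Finset.sum_mul]
    refine Finset.sum_congr rfl fun x hx => ?_
    rw [(Finset.mem_filter.1 hx).2]
  rw [h1, Fintype.sum_prod_type, Finset.mul_sum]
  simp only [Finset.mul_sum]
  rw [Finset.sum_comm]
  refine Finset.sum_congr rfl fun w _ => Finset.sum_congr rfl fun π _ => ?_
  rw [← mul_assoc, ← mul_assoc, mul_inv_cancel₀ (by positivity), one_mul]

/-! ### Uniqueness of the invariant vector and conclusion -/

/-- Pairing with a test function `F` moves `H` onto `F`, the form in which commutation and
stationarity are stated. -/
theorem sum_vecMul_hamiltonian {n : ℕ} (μ F : NCMatching n → ℝ) :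
    ∑ π, Matrix.vecMul μ (hamiltonian n) π * F π =
      ∑ π, μ π * (2 * n * F π - ∑ k, F (temperleyLieb k π)) := by
  classical
  simp only [Matrix.vecMul, dotProduct, Finset.sum_mul]
  rw [Finset.sum_comm]
  refine Finset.sum_congr rfl fun π _ => ?_
  simp only [mul_assoc]
  rw [← Finset.mul_sum]
  congr 1
  simp only [hamiltonian, sub_mul, Finset.sum_sub_distrib, ite_mul, zero_mul, Finset.sum_ite_eq,
    Finset.mem_univ, if_true]
  rw [mul_assoc]
  congr 1
  rw [← Finset.sum_fiberwise (s := Finset.univ) (g := fun k => temperleyLieb k π)]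
  refine Finset.sum_congr rfl fun π' _ => ?_
  rw [Finset.sum_congr rfl fun k hk => by rw [(Finset.mem_filter.1 hk).2], Finset.sum_const,
    nsmul_eq_mul]

theorem mainTheorem8 (n : ℕ) (hn : 1 ≤ n) :
    (∑ π : NCMatching n, connectivityDistribution n π = 1) ∧
      Matrix.vecMul (connectivityDistribution n) (hamiltonian n) = 0 := by
  refine ⟨sum_connectivityDistribution n, ?_⟩
  set μ := connectivityDistribution n
  set ν := Matrix.vecMul μ (hamiltonian n) with hν
  -- Stationarity of `μ`, applied to the test function `H F`, passes to `ν` because `H` commutes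
  -- with the transfer operator.
  have hinv : ∀ F : NCMatching n → ℝ, ∑ π, ν π * ∑ w : Fin (2 * n) → Bool, F (rowMap w π) =
      2 ^ (2 * n) * ∑ π, ν π * F π := by
    intro F
    rw [hν, sum_vecMul_hamiltonian, sum_vecMul_hamiltonian, ← sum_connectivityDistribution_rowMap]
    refine Finset.sum_congr rfl fun π _ => ?_
    rw [Finset.sum_sub_distrib, ← Finset.mul_sum, Finset.sum_comm,
      ← sum_temperleyLieb_rowMap, Finset.sum_comm]
  have hzero : ∑ π, ν π = 0 := by
    have := sum_vecMul_hamiltonian μ fun _ => 1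
    simp only [mul_one] at this
    rw [hν, this]
    simp
  -- Testing invariance with the sign of `ν` turns the right-hand side into the `ℓ¹` norm of `ν`.
  have hle : 2 ^ (2 * n) * ∑ π, |ν π| ≤ (2 ^ (2 * n) - 1) * ∑ π, |ν π| := by
    have h1 := hinv fun π => SignType.sign (ν π)
    simp only [self_mul_sign] at h1
    rw [← h1, Finset.mul_sum]
    -- The alternating row contributes a constant times the sum of `ν`, hence nothing; this saves
    -- one of the `2 ^ (2 * n)` rows.
    have h2 : ∑ π, ν π * ∑ w : Fin (2 * n) → Bool, (SignType.sign (ν (rowMap w π)) : ℝ) =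
        ∑ π, ν π * ∑ w ∈ Finset.univ.erase (alternatingRow n),
          (SignType.sign (ν (rowMap w π)) : ℝ) := by
      rw [← sub_eq_zero, ← Finset.sum_sub_distrib,
        ← zero_mul (SignType.sign (ν (adjacentPairing n)) : ℝ), ← hzero, Finset.sum_mul]
      refine Finset.sum_congr rfl fun π _ => ?_
      rw [← Finset.add_sum_erase _ _ (Finset.mem_univ (alternatingRow n)),
        rowMap_alternatingRow]
      ring
    rw [h2]
    refine Finset.sum_le_sum fun π _ => ?_
    refine (le_abs_self _).trans ?_
    rw [abs_mul, mul_comm]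
    refine mul_le_mul_of_nonneg_right ?_ (abs_nonneg _)
    refine (Finset.abs_sum_le_sum_abs _ _).trans ?_
    refine (Finset.sum_le_sum (g := fun _ => (1 : ℝ)) fun w _ => ?_).trans ?_
    · rcases lt_trichotomy (ν (rowMap w π)) 0 with h | h | h <;> simp [h]
    · rw [Finset.sum_const, Finset.card_erase_of_mem (Finset.mem_univ _), Finset.card_univ]
      simp [Nat.cast_sub Nat.one_le_two_pow]
  have h0 : ∑ π, |ν π| = 0 :=
    le_antisymm (by linarith) (Finset.sum_nonneg fun _ _ => abs_nonneg _)
  funext π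
  exact abs_eq_zero.1 ((Finset.sum_eq_zero_iff_of_nonneg fun _ _ => abs_nonneg _).1 h0 π
    (Finset.mem_univ π))
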